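/- **Setting.** Let $f:\mathbb R^n\to\mathbb R$ and $c=(c_1,\dots,c_m):\mathbb R^n\to\mathbb R^m$ be continuously differentiable, let $0\le\bar m\le m$, $\mathcal E=\{1,\dots,\bar m\}$, $\mathcal I=\{\bar m+1,\dots,m\}$, and consider the problem (NLP) of minimizing $f(x)$ subject to $c_i(x)=0$ $(i\in\mathcal E)$ and $c_i(x)\le 0$ $(i\in\mathcal I)$. Put $t_+=\max\{t,0\}$, $v(x)=\sum_{i\in\mathcal E}|c_i(x)|+\sum_{i\in\mathcal I}(c_i(x))_+$ and $\phi(x,\rho)=\rho f(x)+v(x)$. A point $x$ is *stationary for $v$* if the one-sided directional derivative $v'(x;d)$ is nonnegative for every $d$; an *infeasible stationary point* is an infeasible point of (NLP) that is stationary for $v$. The *MFCQ* holds at $x$ if $v(x)=0$, $\{\nabla c_i(x)\}_{i\in\mathcal E}$ are linearly independent, and there is $d$ with $c_i(x)+\langle\nabla c_i(x),d\rangle=0$ for $i\in\mathcal E$ and $c_i(x)+\langle\nabla c_i(x),d\rangle<0$ for $i\in\mathcal I$. **Subproblem.** Fix a convex set $X\subseteq\mathbb R^n$ with $0\in X$.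 At iteration $k$ write $g=\nabla f(x^k)$, $a^i=\nabla c_i(x^k)$, $b_i=c_i(x^k)$, $\bar a^i=a^i/\|a^i\|_2$, $\bar b_i=b_i/\|a^i\|_2$, and $H_\rho=\rho H_f+H_0$, where $H_f,H_0$ are symmetric matrices (depending on $k$) with $H_\rho$ positive definite for all $\rho\in[0,\rho_{k-1}]$. Let $$l(d,\rho)=\rho\langle g,d\rangle+\sum_{i\in\mathcal E}|b_i+\langle a^i,d\rangle|+\sum_{i\in\mathcal I}(b_i+\langle a^i,d\rangle)_+,\qquad J(d,\rho)=l(d,\rho)+\tfrac12\langle d,H_\rho d\rangle+\delta(d|X),$$ where $\delta(\cdot|X)$ is $0$ on $X$ and $+\infty$ elsewhere, and let $\Delta l(d,\rho)=l(0,\rho)-l(d,\rho)$. Let $C_i=\{d:\langle\bar a^i,d\rangle+\bar b_i=0\}$ for $i\in\mathcal E$ and $C_i=\{d:\langle\bar a^i,d\rangle+\bar b_i\le0\}$ for $i\in\mathcal I$, and let $\delta^*(y|S)=\sup_{d\in S}\langle y,d\rangle$. A point $u=(u^0,\dots,u^{m+1})\in(\mathbb R^n)^{m+2}$ is *dual feasible*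 if $u^0+\sum_{i=1}^m\|a^i\|_2u^i+u^{m+1}=0$ and $\|u^i\|_2\le1$ for $1\le i\le m$; the dual objective is $$D(u,\rho)=-\tfrac12\langle u^0-\rho g,H_\rho^{-1}(u^0-\rho g)\rangle-\sum_{i=1}^m\|a^i\|_2\,\delta^*(u^i|C_i)-\delta^*(u^{m+1}|X).$$ Let $\zeta_i(u)=\langle u^i,\bar a^i\rangle$ and $$\chi(d,u)=\sum_{i:\ \langle\bar a^i,d\rangle+\bar b_i>0}(1-\zeta_i(u))\|a^i\|_2\,\mathrm{dist}(d,C_i)+\sum_{i\in\mathcal E:\ \langle\bar a^i,d\rangle+\bar b_i<0}(1+\zeta_i(u))\|a^i\|_2\,\mathrm{dist}(d,C_i).$$ **Algorithm.** Parameters: $\gamma,\theta_\rho,\theta_\alpha,\theta_\omega,\beta_v,\beta_\phi\in(0,1)$, $\beta_l\in(0,\beta_\phi(1-\beta_v)]$, $\rho_{-1},\omega_0>0$, and arbitrary $x^0\in\mathbb R^n$, $\eta^0\in\mathbb R^m$. For $k=0,1,2,\dots$: 1. Set $\rho_{(0)}=\rho_{k-1}$. For $j=0,1,\dots$ generate $(d^{(j)},u^{(j)},w^{(j)})$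 with $d^{(j)}\in X$, with $u^{(j)},w^{(j)}$ dual feasible, $J(d^{(j)},\rho_{(j)})\le J(0,\rho_{(j)})$ and $D(w^{(j)},0)\ge D(u^{(j)},0)\ge D(u^{(0)},0)>-\infty$. With $J_\omega=v(x^k)+\omega_k$ consider the conditions $$\text{(Rv)}\ \frac{J_\omega-l(d^{(j)},0)}{J_\omega-(D(w^{(j)},0))_+}\ge\beta_v,\qquad\text{(Rphi)}\ \frac{J_\omega-J(d^{(j)},\rho_{(j)})}{J_\omega-D(u^{(j)},\rho_{(j)})}\ge\beta_\phi,\qquad\text{(Rc)}\ \chi(d^{(j)},u^{(j)})\le(1-\beta_v)^2J_\omega.$$ If all three hold, end the inner loop; if (Rphi) and (Rc) hold but (Rv) does not, set $\rho_{(j+1)}=\theta_\rho\rho_{(j)}$; otherwise set $\rho_{(j+1)}=\rho_{(j)}$. When the inner loop ends set $d^k=d^{(j)}$ and $\tilde\rho_k=\rho_{(j)}$. 2. If $\Delta l(d^k,\rho)+\omega_k\ge\beta_l(\Delta l(d^k,0)+\omega_k)$ holds for $\rho=\tilde\rho_k$, set $\rho_k=\tilde\rho_k$. Otherwise choose $\rho_k\in(0,\tilde\rho_k]$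 with $$\rho_k=\frac{(1-\beta_l)(\Delta l(d^k,0)+\omega_k)}{\langle\nabla f(x^k),d^k\rangle+\frac12\langle d^k,H_{\rho_k}d^k\rangle}.$$ 3. Let $\alpha_k$ be the largest element of $\{\gamma^0,\gamma^1,\dots\}$ with $\phi(x^k+\alpha_kd^k,\rho_k)-\phi(x^k,\rho_k)\le-\theta_\alpha\alpha_k\Delta l(d^k,\rho_k)$. 4. Choose $\omega_{k+1}\in(0,\theta_\omega\omega_k]$, set $x^{k+1}=x^k+\alpha_kd^k$ and choose $\eta^{k+1}\in\mathbb R^m$. (The matrices $H_f,H_0$ of iteration $k$ may be any approximations of $\nabla^2f(x^k)$ and $\sum_i\eta^k_i\nabla^2c_i(x^k)$ with the stated properties.) Let $\mathcal D$ be the set of $k$ such that in the $k$-th inner loop (Rphi) and (Rc) hold and (Rv) fails for at least one $j$, and let $\mathcal T$ be the set of $k$ with $\rho_k<\tilde\rho_k$. **Assumption.** The algorithm produces an infinite sequence of iterates (each inner loop and each line search is finite), $X$ is compact and convex with $0\in\operatorname{int}X$, and: (i) there is an open convex set containing all $x^k$ and all $x^k+d^k$ on which $f$ and all $c_i$ are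 twice differentiable and bounded together with their first and second derivatives; (ii) there are constants $0<\underline\Lambda\le\overline\Lambda$ such that for all $k$ and all $\rho\in[0,\rho_0]$ the eigenvalues of the matrix $H_\rho$ of iteration $k$ lie in $[\underline\Lambda,\overline\Lambda]$; (iii) the dual points $u^{(j)}$ and $w^{(j)}$ generated in all inner loops are bounded in norm by a constant $K_0$ independent of $k$ and $j$; (iv) $\|\nabla c_i(x^k)\|_2>0$ for all $k$ and $i$; (v) $\{\eta^k\}$ is bounded. **Theorem.** Under this Assumption, if $\rho_k\to0$, then every limit point of $\{x^k\}_{k\in\mathcal D\cup\mathcal T}$ is either an infeasible stationary point or a feasible point at which the MFCQ does not hold. -/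

import Mathlib

open Filter Topology

noncomputable section

namespace PenaltySQP

abbrev Vec (n : ℕ) := EuclideanSpace ℝ (Fin n)

/-- The penalty term of the `i`-th constraint: indices below `mbar` are equality constraints,
the others are inequality constraints. -/
def viol {m : ℕ} (mbar : ℕ) (i : Fin m) (t : ℝ) : ℝ :=
  if (i : ℕ) < mbar then |t| else max t 0

/-- The quadratic form `⟨d, M d⟩`. -/
def quad {n : ℕ} (M : Matrix (Fin n) (Fin n) ℝ) (d : Vec n) : ℝ :=
  d.ofLp ⬝ᵥ (M.mulVec d.ofLp)

/-- The support function `δ*(y | S)`, with values in the extended reals. -/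
def supportFn {n : ℕ} (S : Set (Vec n)) (y : Vec n) : EReal :=
  ⨆ d ∈ S, ((inner ℝ y d : ℝ) : EReal)

/-! ### The nonlinear program -/

/-- Minimize `f x` subject to `c i x = 0` for the first `mbar` indices and `c i x ≤ 0` for the
remaining ones. -/
structure NLP (n m : ℕ) where
  mbar : ℕ
  mbar_le : mbar ≤ m
  f : Vec n → ℝ
  c : Fin m → Vec n → ℝ
  f_smooth : ContDiff ℝ 1 f
  c_smooth : ∀ i, ContDiff ℝ 1 (c i)

namespace NLP

variable {n m : ℕ} (P : NLP n m)

/-- The infeasibility measure. -/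
def v (x : Vec n) : ℝ := ∑ i, viol P.mbar i (P.c i x)

/-- The exact penalty function. -/
def phi (x : Vec n) (ρ : ℝ) : ℝ := ρ * P.f x + P.v x

def Feasible (x : Vec n) : Prop :=
  ∀ i : Fin m, ((i : ℕ) < P.mbar → P.c i x = 0) ∧ (P.mbar ≤ (i : ℕ) → P.c i x ≤ 0)

/-- First-order stationarity for `v`: every one-sided directional derivative of `v` at `x` exists
and is nonnegative. -/
def StationaryForViolation (x : Vec n) : Prop :=
  ∀ d : Vec n, ∃ L : ℝ, 0 ≤ L ∧
    Tendsto (fun t : ℝ => (P.v (x + t • d) - P.v x) / t) (𝓝[>] 0) (𝓝 L)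

def InfeasibleStationary (x : Vec n) : Prop :=
  ¬ P.Feasible x ∧ P.StationaryForViolation x

/-- The Mangasarian-Fromovitz constraint qualification. -/
def MFCQ (x : Vec n) : Prop :=
  P.v x = 0 ∧
  LinearIndependent ℝ (fun i : {i : Fin m // (i : ℕ) < P.mbar} => gradient (P.c i) x) ∧
  ∃ d : Vec n,
    (∀ i : Fin m, (i : ℕ) < P.mbar → P.c i x + inner ℝ (gradient (P.c i) x) d = 0) ∧
    (∀ i : Fin m, P.mbar ≤ (i : ℕ) → P.c i x + inner ℝ (gradient (P.c i) x) d < 0)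

end NLP

/-! ### The quadratic subproblem and its dual -/

structure QP (n m : ℕ) where
  mbar : ℕ
  X : Set (Vec n)
  g : Vec n
  a : Fin m → Vec n
  b : Fin m → ℝ
  Hf : Matrix (Fin n) (Fin n) ℝ
  H0 : Matrix (Fin n) (Fin n) ℝ

/-- A point `(u⁰, (u¹, …, uᵐ), uᵐ⁺¹)` of the dual space. -/
structure DualPoint (n m : ℕ) where
  zero : Vec n
  con : Fin m → Vec n
  last : Vec n

/-- The Euclidean norm of a dual point. -/
def DualPoint.norm {n m : ℕ} (u : DualPoint n m) : ℝ :=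
  Real.sqrt (‖u.zero‖ ^ 2 + ∑ i, ‖u.con i‖ ^ 2 + ‖u.last‖ ^ 2)

namespace QP

variable {n m : ℕ} (Q : QP n m)

def H (ρ : ℝ) : Matrix (Fin n) (Fin n) ℝ := ρ • Q.Hf + Q.H0

/-- The linearized model of the penalty function. -/
def l (d : Vec n) (ρ : ℝ) : ℝ :=
  ρ * inner ℝ Q.g d + ∑ i, viol Q.mbar i (Q.b i + inner ℝ (Q.a i) d)

/-- The model reduction `Δl(d, ρ)`. -/
def dl (d : Vec n) (ρ : ℝ) : ℝ := Q.l 0 ρ - Q.l d ρ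

open Classical in
/-- The quadratic model, including the indicator function of `X`. -/
def J (d : Vec n) (ρ : ℝ) : EReal :=
  if d ∈ Q.X then ((Q.l d ρ + 1 / 2 * quad (Q.H ρ) d : ℝ) : EReal) else ⊤

def abar (i : Fin m) : Vec n := ‖Q.a i‖⁻¹ • Q.a i

def bbar (i : Fin m) : ℝ := Q.b i / ‖Q.a i‖

/-- The set of steps that satisfy the `i`-th linearized constraint. -/
def C (i : Fin m) : Set (Vec n) :=
  {d | if (i : ℕ) < Q.mbar then inner ℝ (Q.abar i) d + Q.bbar i = 0
    else inner ℝ (Q.abar i) d + Q.bbar i ≤ 0}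

def DualFeasible (u : DualPoint n m) : Prop :=
  u.zero + ∑ i, ‖Q.a i‖ • u.con i + u.last = 0 ∧ ∀ i, ‖u.con i‖ ≤ 1

/-- The dual objective, with values in the extended reals. -/
def D (u : DualPoint n m) (ρ : ℝ) : EReal :=
  ((-(1 / 2) * quad (Q.H ρ)⁻¹ (u.zero - ρ • Q.g) : ℝ) : EReal)
    - ∑ i, ((‖Q.a i‖ : ℝ) : EReal) * supportFn (Q.C i) (u.con i)
    - supportFn Q.X u.last

def zeta (u : DualPoint n m) (i : Fin m) : ℝ := inner ℝ (u.con i) (Q.abar i)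

/-- The complementarity measure: violated constraints with positive residual have the weight
`1 - ζ_i`, equality constraints with negative residual the weight `1 + ζ_i`. -/
def chi (d : Vec n) (u : DualPoint n m) : ℝ :=
  ∑ i, if 0 < inner ℝ (Q.abar i) d + Q.bbar i then
      (1 - Q.zeta u i) * ‖Q.a i‖ * Metric.infDist d (Q.C i)
    else if (i : ℕ) < Q.mbar ∧ inner ℝ (Q.abar i) d + Q.bbar i < 0 then
      (1 + Q.zeta u i) * ‖Q.a i‖ * Metric.infDist d (Q.C i)
    else 0

/-- `J(0, ρ) + ω`, which does not depend on `ρ`. -/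
def Jomega (ω : ℝ) : ℝ := ∑ i, viol Q.mbar i (Q.b i) + ω

def rv (ω : ℝ) (d : Vec n) (w : DualPoint n m) : ℝ :=
  (Q.Jomega ω - Q.l d 0) / (Q.Jomega ω - max (Q.D w 0).toReal 0)

def rphi (ω : ℝ) (d : Vec n) (u : DualPoint n m) (ρ : ℝ) : ℝ :=
  (Q.Jomega ω - (Q.J d ρ).toReal) / (Q.Jomega ω - (Q.D u ρ).toReal)

end QP

/-! ### The algorithm -/

structure Params where
  gamma : ℝ
  thetaRho : ℝ
  thetaAlpha : ℝ
  thetaOmega : ℝ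
  betaV : ℝ
  betaPhi : ℝ
  betaL : ℝ
  gamma_mem : gamma ∈ Set.Ioo (0 : ℝ) 1
  thetaRho_mem : thetaRho ∈ Set.Ioo (0 : ℝ) 1
  thetaAlpha_mem : thetaAlpha ∈ Set.Ioo (0 : ℝ) 1
  thetaOmega_mem : thetaOmega ∈ Set.Ioo (0 : ℝ) 1
  betaV_mem : betaV ∈ Set.Ioo (0 : ℝ) 1
  betaPhi_mem : betaPhi ∈ Set.Ioo (0 : ℝ) 1
  betaL_mem : betaL ∈ Set.Ioc (0 : ℝ) (betaPhi * (1 - betaV))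

/-- All quantities that a run of the algorithm produces. The `k`-th inner loop performs the
iterations `0, …, jEnd k`; entries with inner index above `jEnd k` are meaningless. -/
structure Iterates (n m : ℕ) where
  x : ℕ → Vec n
  eta : ℕ → Vec m
  omega : ℕ → ℝ
  /-- the initial penalty parameter, with index `-1` -/
  rhoInit : ℝ
  rho : ℕ → ℝ
  alpha : ℕ → ℝ
  Hf : ℕ → Matrix (Fin n) (Fin n) ℝ
  H0 : ℕ → Matrix (Fin n) (Fin n) ℝ
  jEnd : ℕ → ℕ
  dIn : ℕ → ℕ → Vec n
  uIn : ℕ → ℕ → DualPoint n m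
  wIn : ℕ → ℕ → DualPoint n m
  rhoIn : ℕ → ℕ → ℝ

namespace Iterates

variable {n m : ℕ} (it : Iterates n m) (P : NLP n m) (X : Set (Vec n)) (par : Params)

/-- The penalty parameter `ρ_{k-1}`. -/
def rhoPrev : ℕ → ℝ
  | 0 => it.rhoInit
  | k + 1 => it.rho k

/-- The search direction `d^k`. -/
def d (k : ℕ) : Vec n := it.dIn k (it.jEnd k)

/-- The penalty parameter at the end of the `k`-th inner loop. -/
def rhoTilde (k : ℕ) : ℝ := it.rhoIn k (it.jEnd k)

/-- The data of the `k`-th subproblem. -/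
def qp (k : ℕ) : QP n m where
  mbar := P.mbar
  X := X
  g := gradient P.f (it.x k)
  a := fun i => gradient (P.c i) (it.x k)
  b := fun i => P.c i (it.x k)
  Hf := it.Hf k
  H0 := it.H0 k

/-- Sufficient reduction of the feasibility model. -/
def RedV (k j : ℕ) : Prop :=
  par.betaV ≤ (it.qp P X k).rv (it.omega k) (it.dIn k j) (it.wIn k j)

/-- Sufficient reduction of the penalty model. -/
def RedPhi (k j : ℕ) : Prop :=
  par.betaPhi ≤ (it.qp P X k).rphi (it.omega k) (it.dIn k j) (it.uIn k j) (it.rhoIn k j)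

/-- Approximate complementarity. -/
def RedC (k j : ℕ) : Prop :=
  (it.qp P X k).chi (it.dIn k j) (it.uIn k j) ≤
    (1 - par.betaV) ^ 2 * (it.qp P X k).Jomega (it.omega k)

/-- The condition that is checked after the inner loop, at the penalty parameter `ρ`. -/
def Posterior (k : ℕ) (ρ : ℝ) : Prop :=
  par.betaL * ((it.qp P X k).dl (it.d k) 0 + it.omega k) ≤
    (it.qp P X k).dl (it.d k) ρ + it.omega k

/-- The sufficient decrease condition of the line search, for the stepsize `s`. -/
def LineSearch (k : ℕ) (s : ℝ) : Prop :=
  P.phi (it.x k + s • it.d k) (it.rho k) - P.phi (it.x k) (it.rho k) ≤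
    -par.thetaAlpha * s * (it.qp P X k).dl (it.d k) (it.rho k)

/-- `it` is an infinite run of the algorithm. -/
structure IsRun : Prop where
  rhoInit_pos : 0 < it.rhoInit
  omega_zero_pos : 0 < it.omega 0
  Hf_symm : ∀ k, (it.Hf k).IsSymm
  H0_symm : ∀ k, (it.H0 k).IsSymm
  H_posDef : ∀ k, ∀ ρ ∈ Set.Icc 0 (it.rhoPrev k), ((it.qp P X k).H ρ).PosDef
  primal_mem : ∀ k, ∀ j ≤ it.jEnd k, it.dIn k j ∈ X
  u_feasible : ∀ k, ∀ j ≤ it.jEnd k, (it.qp P X k).DualFeasible (it.uIn k j)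
  w_feasible : ∀ k, ∀ j ≤ it.jEnd k, (it.qp P X k).DualFeasible (it.wIn k j)
  primal_le : ∀ k, ∀ j ≤ it.jEnd k,
    (it.qp P X k).J (it.dIn k j) (it.rhoIn k j) ≤ (it.qp P X k).J 0 (it.rhoIn k j)
  dual_w_ge : ∀ k, ∀ j ≤ it.jEnd k,
    (it.qp P X k).D (it.uIn k j) 0 ≤ (it.qp P X k).D (it.wIn k j) 0
  dual_u_ge : ∀ k, ∀ j ≤ it.jEnd k,
    (it.qp P X k).D (it.uIn k 0) 0 ≤ (it.qp P X k).D (it.uIn k j) 0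
  dual_finite : ∀ k, ⊥ < (it.qp P X k).D (it.uIn k 0) 0
  rhoIn_zero : ∀ k, it.rhoIn k 0 = it.rhoPrev k
  /-- the inner loop goes on as long as one of the three conditions fails -/
  not_stopped : ∀ k, ∀ j < it.jEnd k,
    ¬ (it.RedPhi P X par k j ∧ it.RedC P X par k j ∧ it.RedV P X par k j)
  rhoIn_reduce : ∀ k, ∀ j < it.jEnd k,
    it.RedPhi P X par k j → it.RedC P X par k j → ¬ it.RedV P X par k j →
      it.rhoIn k (j + 1) = par.thetaRho * it.rhoIn k j
  rhoIn_keep : ∀ k, ∀ j < it.jEnd k,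
    ¬ (it.RedPhi P X par k j ∧ it.RedC P X par k j) → it.rhoIn k (j + 1) = it.rhoIn k j
  stopped : ∀ k, it.RedPhi P X par k (it.jEnd k) ∧ it.RedC P X par k (it.jEnd k) ∧
    it.RedV P X par k (it.jEnd k)
  rho_keep : ∀ k, it.Posterior P X par k (it.rhoTilde k) → it.rho k = it.rhoTilde k
  rho_reduce : ∀ k, ¬ it.Posterior P X par k (it.rhoTilde k) →
    0 < it.rho k ∧ it.rho k ≤ it.rhoTilde k ∧
    it.rho k = (1 - par.betaL) * ((it.qp P X k).dl (it.d k) 0 + it.omega k) /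
      (inner ℝ (gradient P.f (it.x k)) (it.d k)
        + 1 / 2 * quad ((it.qp P X k).H (it.rho k)) (it.d k))
  alpha_eq : ∀ k, ∃ i : ℕ, it.alpha k = par.gamma ^ i ∧
    it.LineSearch P X par k (par.gamma ^ i) ∧
    ∀ i' < i, ¬ it.LineSearch P X par k (par.gamma ^ i')
  omega_succ : ∀ k, 0 < it.omega (k + 1) ∧ it.omega (k + 1) ≤ par.thetaOmega * it.omega k
  x_succ : ∀ k, it.x (k + 1) = it.x k + it.alpha k • it.d k

/-- The inner iterations of the `k`-th subproblem at which the penalty parameter is reduced. -/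
def reducing (k : ℕ) : Set ℕ :=
  {j | j ≤ it.jEnd k ∧ it.RedPhi P X par k j ∧ it.RedC P X par k j ∧ ¬ it.RedV P X par k j}

/-- The iterations whose inner loop reduces the penalty parameter. -/
def setD : Set ℕ := {k | (it.reducing P X par k).Nonempty}

/-- The iterations in which the penalty parameter is reduced after the inner loop. -/
def setT : Set ℕ := {k | it.rho k < it.rhoTilde k}

end Iterates

/-- `h` and its first and second derivatives are bounded on `Ω`. -/
def BoundedC2On {n : ℕ} (h : Vec n → ℝ) (Ω : Set (Vec n)) : Prop :=
  DifferentiableOn ℝ h Ω ∧ DifferentiableOn ℝ (gradient h) Ω ∧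
  ∃ B : ℝ, ∀ x ∈ Ω, |h x| ≤ B ∧ ‖gradient h x‖ ≤ B ∧ ‖fderiv ℝ (gradient h) x‖ ≤ B

/-- The assumptions of the global convergence analysis. -/
structure GlobalAssumption {n m : ℕ} (P : NLP n m) (X : Set (Vec n)) (it : Iterates n m) :
    Prop where
  X_compact : IsCompact X
  X_convex : Convex ℝ X
  zero_mem_interior : (0 : Vec n) ∈ interior X
  smooth : ∃ Ω : Set (Vec n), IsOpen Ω ∧ Convex ℝ Ω ∧
    (∀ k, it.x k ∈ Ω ∧ it.x k + it.d k ∈ Ω) ∧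
    BoundedC2On P.f Ω ∧ ∀ i, BoundedC2On (P.c i) Ω
  eigenvalues : ∃ lo hi : ℝ, 0 < lo ∧ lo ≤ hi ∧
    ∀ k, ∀ ρ ∈ Set.Icc 0 (it.rho 0), spectrum ℝ ((it.qp P X k).H ρ) ⊆ Set.Icc lo hi
  dual_bounded : ∃ K : ℝ, 0 < K ∧
    ∀ k, ∀ j ≤ it.jEnd k, (it.uIn k j).norm ≤ K ∧ (it.wIn k j).norm ≤ K
  gradient_pos : ∀ k i, 0 < ‖gradient (P.c i) (it.x k)‖
  eta_bounded : ∃ B : ℝ, ∀ k, ‖it.eta k‖ ≤ B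

/-- `z` is a limit point of the subsequence of `x` with indices in `S`. -/
def IsLimitPointAlong {n : ℕ} (x : ℕ → Vec n) (S : Set ℕ) (z : Vec n) : Prop :=
  ∃ s : ℕ → ℕ, StrictMono s ∧ (∀ i, s i ∈ S) ∧ Tendsto (fun i => x (s i)) atTop (𝓝 z)

end PenaltySQP

end

namespace PenaltySQP

/-! ### The penalty terms -/

section Viol

variable {m mbar : ℕ} {i : Fin m}

/-! An infeasible limit point is handled by descent. The shifted merit values `ρ_k (f + B_f) + v`
are nonnegative and, from index 1 on, nonincreasing, and the stepsizes are bounded below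
(`le_alpha`), so `Δl(d^k, ρ_k) → 0` (`tendsto_dl`). The posterior test transfers this to `Δl(d^k,
0)`, and (Rv) with weak duality then gives `v(x^k) - e_k ≤ vModel(x^k, d) + K‖d‖²` for every fixed
`d ∈ X`, with `e_k → 0`. In the limit, `stationaryForViolation_of_le` yields stationarity; this half
does not need `ρ_k → 0`.

A feasible limit point is handled by multipliers. A reduction of the penalty parameter forces some
`|ζ_i| > β_v` at an inner iteration where (Rphi) holds (`exists_zeta_gt`): otherwise (Rc) would
imply (Rv), or (Rphi) would imply the posterior test. By (Rphi) the dual objective is at least a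
quantity tending to zero, since `v`, `ω` and `ρ` all vanish in the limit. Hence `∑ ζ_i ∇c_i → 0`,
and `∑ ζ_i c_i` is asymptotically nonnegative (`multiplier_estimate`). A cluster point of the
multipliers is nonzero, which the MFCQ excludes (`MFCQ.eq_zero`). -/

lemma viol_nonneg (t : ℝ) : 0 ≤ viol mbar i t := by
  unfold viol; split_ifs <;> positivity

lemma viol_le_add_abs (s t : ℝ) : viol mbar i s ≤ viol mbar i t + |s - t| := by
  unfold viol
  split_ifs
  · have := abs_sub_abs_le_abs_sub s t; linarith
  · have := le_abs_self (s - t)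
    exact max_le (by linarith [le_max_left t 0]) (by positivity)

lemma continuous_viol : Continuous (viol mbar i) := by
  unfold viol
  split_ifs <;> fun_prop

lemma convexOn_viol : ConvexOn ℝ Set.univ (viol mbar i) := by
  unfold viol
  split_ifs
  · exact convexOn_norm convex_univ
  · exact (convexOn_id convex_univ).sup (convexOn_const 0 convex_univ)

lemma viol_eq_zero_of_sat {t : ℝ} (h0 : (i : ℕ) < mbar → t = 0) (h1 : mbar ≤ (i : ℕ) → t ≤ 0) :
    viol mbar i t = 0 := by
  unfold viol
  split_ifs with h
  · simp [h0 h]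
  · simpa using h1 (not_lt.1 h)

/-- The bound `Z` is kept free: weak duality uses `Z = 1`, the comparison with the posterior test
uses `Z = β_v`. -/
lemma mul_le_viol {ζ t Z : ℝ} (hZ : |ζ| ≤ Z) (h0 : mbar ≤ (i : ℕ) → 0 ≤ ζ) :
    ζ * t ≤ Z * viol mbar i t := by
  unfold viol
  split_ifs with h
  · calc ζ * t ≤ |ζ * t| := le_abs_self _
      _ = |ζ| * |t| := abs_mul _ _
      _ ≤ Z * |t| := by gcongr
  · have h0 := h0 (not_lt.1 h)
    calc ζ * t ≤ ζ * max t 0 := by gcongr; exact le_max_left _ _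
      _ ≤ Z * max t 0 := by gcongr; exact (le_abs_self ζ).trans hZ

end Viol

/-! ### Quadratic forms -/

section Quad

variable {n : ℕ} {A : Matrix (Fin n) (Fin n) ℝ}

lemma norm_sq_eq_dotProduct (d : Vec n) : ‖d‖ ^ 2 = d.ofLp ⬝ᵥ d.ofLp := by
  rw [EuclideanSpace.real_norm_sq_eq]; simp [dotProduct, sq]

lemma inner_eq_dotProduct (x y : Vec n) : inner ℝ x y = x.ofLp ⬝ᵥ y.ofLp := by
  rw [EuclideanSpace.inner_eq_star_dotProduct, dotProduct_comm]; simp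

/-- The matrix `c I - A` is symmetric with nonnegative spectrum, hence positive semidefinite. -/
lemma quad_le_of_spectrum {c : ℝ} (hA : A.IsSymm) (h : ∀ r ∈ spectrum ℝ A, r ≤ c) (d : Vec n) :
    quad A d ≤ c * ‖d‖ ^ 2 := by
  have hps : (algebraMap ℝ (Matrix (Fin n) (Fin n) ℝ) c - A).PosSemidef := by
    rw [Matrix.posSemidef_iff_isHermitian_and_spectrum_nonneg]
    refine ⟨?_, ?_⟩
    · rw [Matrix.algebraMap_eq_diagonal]
      exact (Matrix.isHermitian_diagonal _).sub (by simpa [Matrix.IsHermitian, Matrix.IsSymm] using hA)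
    · rw [← spectrum.singleton_sub_eq]
      rintro _ ⟨a, ha, b, hb, rfl⟩
      rw [Set.mem_singleton_iff] at ha
      subst ha
      exact sub_nonneg.2 (h b hb)
  have := hps.dotProduct_mulVec_nonneg d.ofLp
  rw [norm_sq_eq_dotProduct]
  simp only [star_trivial, Matrix.sub_mulVec, dotProduct_sub, Algebra.algebraMap_eq_smul_one,
    Matrix.smul_mulVec, Matrix.one_mulVec, dotProduct_smul, smul_eq_mul] at this
  unfold quad
  linarith

lemma le_quad_of_spectrum {c : ℝ} (hA : A.IsSymm) (h : ∀ r ∈ spectrum ℝ A, c ≤ r) (d : Vec n) :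
    c * ‖d‖ ^ 2 ≤ quad A d := by
  have := quad_le_of_spectrum (A := -A) (c := -c) (by simpa [Matrix.IsSymm] using hA)
    (fun r hr => by
      rw [← spectrum.neg_eq] at hr
      linarith [h _ (Set.mem_neg.1 hr)]) d
  have h2 : quad (-A) d = -quad A d := by simp [quad, Matrix.neg_mulVec]
  rw [h2] at this
  linarith

lemma quad_nonneg (hA : A.PosDef) (d : Vec n) : 0 ≤ quad A d := by
  simpa [quad] using hA.posSemidef.dotProduct_mulVec_nonneg d.ofLp

lemma quad_zero : quad A (0 : Vec n) = 0 := by simp [quad]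

/-- The eigenvalues of `A⁻¹` are at least `1 / c`. This turns a small quadratic term of the dual
objective into a small vector `u⁰ - ρ g`. -/
lemma norm_sq_le_quad_inv {c : ℝ} (hc : 0 < c) (hA : A.PosDef)
    (h : ∀ r ∈ spectrum ℝ A, r ≤ c) (y : Vec n) : ‖y‖ ^ 2 ≤ c * quad A⁻¹ y := by
  have hs : A⁻¹.IsSymm := by
    simpa [Matrix.IsHermitian, Matrix.IsSymm] using hA.inv.isHermitian
  have := le_quad_of_spectrum (A := A⁻¹) (c := c⁻¹) hs (fun r hr => by
    obtain ⟨a, rfl⟩ := hA.isUnit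
    rw [← Matrix.coe_units_inv, ← spectrum.map_inv] at hr
    have hr' := h _ (Set.mem_inv.1 hr)
    have hpos : 0 < r⁻¹ := by
      have h1 := (Matrix.posSemidef_iff_isHermitian_and_spectrum_nonneg.1 hA.posSemidef).2
        (Set.mem_inv.1 hr)
      have h2 : r⁻¹ ≠ 0 := fun h0 => by
        have := Set.mem_inv.1 hr
        rw [h0] at this
        exact spectrum.zero_notMem ℝ a.isUnit this
      exact lt_of_le_of_ne h1 (Ne.symm h2)
    exact inv_le_of_inv_le₀ (inv_pos.1 hpos) hr') y
  rw [inv_mul_le_iff₀ hc] at this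
  exact this

/-- The Fenchel-Young inequality for a positive definite quadratic form. -/
lemma inner_le_quad_inv_add_quad (hA : A.PosDef) (y d : Vec n) :
    inner ℝ y d ≤ 1 / 2 * quad A⁻¹ y + 1 / 2 * quad A d := by
  have hU : IsUnit A.det := (Matrix.isUnit_iff_isUnit_det _).1 hA.isUnit
  have hs : A.transpose = A := by
    simpa [Matrix.IsHermitian] using hA.isHermitian
  set z := A⁻¹.mulVec y.ofLp with hz
  have hAz : A.mulVec z = y.ofLp := by
    rw [hz, Matrix.mulVec_mulVec, Matrix.mul_nonsing_inv _ hU, Matrix.one_mulVec]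
  -- Expanding the form at `d - A⁻¹ y` gives the inequality.
  have h := hA.posSemidef.dotProduct_mulVec_nonneg (d.ofLp - z)
  have h2 : z ⬝ᵥ A.mulVec d.ofLp = y.ofLp ⬝ᵥ d.ofLp := by
    rw [Matrix.dotProduct_mulVec, ← Matrix.mulVec_transpose, hs, hAz]
  simp only [star_trivial, Matrix.mulVec_sub, dotProduct_sub, sub_dotProduct, hAz, h2] at h
  rw [inner_eq_dotProduct]
  unfold quad
  rw [← hz]
  have h3 := dotProduct_comm d.ofLp y.ofLp
  have h4 := dotProduct_comm z y.ofLp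
  linarith

end Quad

/-! ### Support functions -/

lemma ereal_coe_sum {ι : Type*} (s : Finset ι) (f : ι → ℝ) :
    ((∑ i ∈ s, f i : ℝ) : EReal) = ∑ i ∈ s, (f i : EReal) := by
  classical
  induction s using Finset.induction_on with
  | empty => simp
  | insert a s ha ih => rw [Finset.sum_insert ha, Finset.sum_insert ha, EReal.coe_add, ih]

lemma ereal_sum_ne_bot {ι : Type*} {s : Finset ι} {f : ι → EReal} (hb : ∀ i ∈ s, f i ≠ ⊥) :
    ∑ i ∈ s, f i ≠ ⊥ := by
  classical
  induction s using Finset.induction_on with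
  | empty => simp
  | insert a s ha ih =>
    rw [Finset.sum_insert ha]
    rw [Ne, EReal.add_eq_bot_iff, not_or]
    exact ⟨hb a (by simp), ih fun i hi => hb i (by simp [hi])⟩

lemma ereal_ne_top_of_sum_ne_top {ι : Type*} {s : Finset ι} {f : ι → EReal}
    (hb : ∀ i ∈ s, f i ≠ ⊥) (h : ∑ i ∈ s, f i ≠ ⊤) {i : ι} (hi : i ∈ s) : f i ≠ ⊤ := by
  classical
  intro htop
  apply h
  rw [← Finset.add_sum_erase s f hi, htop]
  exact EReal.top_add_of_ne_bot
    (ereal_sum_ne_bot fun j hj => hb j (Finset.mem_of_mem_erase hj))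

lemma inner_le_supportFn {n : ℕ} {S : Set (Vec n)} {d : Vec n} (hd : d ∈ S) (y : Vec n) :
    ((inner ℝ y d : ℝ) : EReal) ≤ supportFn S y :=
  le_iSup₂ (f := fun d (_ : d ∈ S) => ((inner ℝ y d : ℝ) : EReal)) d hd

lemma supportFn_ne_bot {n : ℕ} {S : Set (Vec n)} (hS : S.Nonempty) (y : Vec n) :
    supportFn S y ≠ ⊥ := by
  obtain ⟨d, hd⟩ := hS
  exact ne_bot_of_le_ne_bot (EReal.coe_ne_bot _) (inner_le_supportFn hd y)

lemma exists_supportFn_eq_coe {n : ℕ} {S : Set (Vec n)} (hS : S.Nonempty) {y : Vec n}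
    (h : supportFn S y ≠ ⊤) :
    ∃ s : ℝ, supportFn S y = s ∧ ∀ d ∈ S, inner ℝ y d ≤ s := by
  refine ⟨(supportFn S y).toReal, (EReal.coe_toReal h (supportFn_ne_bot hS y)).symm, ?_⟩
  intro d hd
  rw [← EReal.coe_le_coe_iff, EReal.coe_toReal h (supportFn_ne_bot hS y)]
  exact inner_le_supportFn hd y

namespace QP

variable {n m : ℕ} {Q : QP n m}

lemma norm_abar {i : Fin m} (ha : 0 < ‖Q.a i‖) : ‖Q.abar i‖ = 1 := by
  rw [abar, norm_smul, norm_inv, norm_norm, inv_mul_cancel₀ ha.ne']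

lemma norm_smul_abar {i : Fin m} (ha : 0 < ‖Q.a i‖) : ‖Q.a i‖ • Q.abar i = Q.a i := by
  rw [abar, smul_smul, mul_inv_cancel₀ ha.ne', one_smul]

lemma norm_mul_bbar {i : Fin m} (ha : 0 < ‖Q.a i‖) : ‖Q.a i‖ * Q.bbar i = Q.b i := by
  rw [bbar, mul_div_cancel₀ _ ha.ne']

lemma norm_mul_residual {i : Fin m} (ha : 0 < ‖Q.a i‖) (d : Vec n) :
    ‖Q.a i‖ * (inner ℝ (Q.abar i) d + Q.bbar i) = Q.b i + inner ℝ (Q.a i) d := by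
  conv_rhs => rw [← norm_smul_abar ha, ← norm_mul_bbar ha, real_inner_smul_left]
  ring

/-- The points that differ from `-b̄ ā` by a vector orthogonal to `ā`, and for an inequality
constraint by a further nonpositive multiple of `ā`, are feasible for the constraint. -/
lemma mem_C_of_orthogonal {i : Fin m} (ha : 0 < ‖Q.a i‖) {y : Vec n}
    (hy : inner ℝ (Q.abar i) y = 0) {t : ℝ} (ht0 : (i : ℕ) < Q.mbar → t = 0)
    (ht : t ≤ 0) : (-Q.bbar i) • Q.abar i + t • Q.abar i + y ∈ Q.C i := by
  have h1 : inner ℝ (Q.abar i) ((-Q.bbar i) • Q.abar i + t • Q.abar i + y) + Q.bbar i = t := by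
    rw [inner_add_right, inner_add_right, real_inner_smul_right, real_inner_smul_right, hy,
      real_inner_self_eq_norm_sq, norm_abar ha]
    ring
  simp only [C, Set.mem_ofPred_eq, h1]
  split_ifs with h
  · exact ht0 h
  · exact ht

lemma C_nonempty {i : Fin m} (ha : 0 < ‖Q.a i‖) : (Q.C i).Nonempty :=
  ⟨_, mem_C_of_orthogonal ha (inner_zero_right _) (t := 0) (fun _ => rfl) le_rfl⟩

/-- The effective domain of the support function of a linear constraint, and its value there. -/
lemma supportFn_C {i : Fin m} (ha : 0 < ‖Q.a i‖) {y : Vec n} (h : supportFn (Q.C i) y ≠ ⊤) :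
    y = (inner ℝ y (Q.abar i) : ℝ) • Q.abar i ∧
    (Q.mbar ≤ (i : ℕ) → 0 ≤ (inner ℝ y (Q.abar i) : ℝ)) ∧
    supportFn (Q.C i) y = ((-(inner ℝ y (Q.abar i) * Q.bbar i) : ℝ) : EReal) := by
  obtain ⟨s, hs, hle⟩ := exists_supportFn_eq_coe (C_nonempty ha) h
  set ζ : ℝ := inner ℝ y (Q.abar i) with hζ
  have h1 : y = ζ • Q.abar i := by
    -- The set `C i` is invariant under translations orthogonal to `ā`, so a nonzero orthogonal part
    -- `w` of `y` would make the support function infinite.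
    set w := y - ζ • Q.abar i with hw
    have hwa : inner ℝ (Q.abar i) w = 0 := by
      rw [hw, inner_sub_right, real_inner_smul_right, real_inner_self_eq_norm_sq, norm_abar ha,
        real_inner_comm, ← hζ]
      ring
    have hyw : (inner ℝ y w : ℝ) = ‖w‖ ^ 2 := by
      have : y = w + ζ • Q.abar i := by rw [hw]; abel
      conv_lhs => rw [this]
      rw [inner_add_left, real_inner_smul_left, hwa, real_inner_self_eq_norm_sq]
      ring
    by_contra hne
    have hw0 : w ≠ 0 := fun h0 => hne (sub_eq_zero.1 h0)
    have hpos : 0 < ‖w‖ ^ 2 := by positivity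
    have key : ∀ t : ℝ, -(ζ * Q.bbar i) + t * ‖w‖ ^ 2 ≤ s := by
      intro t
      have := hle _ (mem_C_of_orthogonal ha (y := t • w)
        (by rw [real_inner_smul_right, hwa, mul_zero]) (t := 0) (fun _ => rfl) le_rfl)
      rw [inner_add_right, inner_add_right, real_inner_smul_right, real_inner_smul_right,
        real_inner_smul_right, hyw, ← hζ] at this
      linarith
    have := key ((s + ζ * Q.bbar i + 1) / ‖w‖ ^ 2)
    rw [div_mul_cancel₀ _ hpos.ne'] at this
    linarith
  have h2 : Q.mbar ≤ (i : ℕ) → 0 ≤ ζ := by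
    intro hi
    by_contra hneg
    push Not at hneg
    -- An inequality constraint also admits the direction `-ā`, along which a negative `ζ` would
    -- give an infinite supremum. The value at `t = 0` ensures that the `t` used below is
    -- nonpositive.
    have key : ∀ t : ℝ, t ≤ 0 → -(ζ * Q.bbar i) + t * ζ ≤ s := by
      intro t ht
      have := hle _ (mem_C_of_orthogonal ha (y := 0) (inner_zero_right _) (t := t)
        (fun h' => absurd h' (not_lt.2 hi)) ht)
      rw [inner_add_right, inner_add_right, real_inner_smul_right, real_inner_smul_right,
        inner_zero_right, ← hζ] at this
      linarith
    have h0 := key 0 le_rfl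
    have := key ((s + ζ * Q.bbar i + 1) / ζ)
      (div_nonpos_of_nonneg_of_nonpos (by linarith) hneg.le)
    rw [div_mul_cancel₀ _ hneg.ne] at this
    linarith
  refine ⟨h1, h2, ?_⟩
  apply le_antisymm
  · refine iSup₂_le fun d hd => ?_
    rw [EReal.coe_le_coe_iff]
    have hdi : (inner ℝ y d : ℝ) = ζ * inner ℝ (Q.abar i) d := by
      conv_lhs => rw [h1]
      rw [real_inner_smul_left]
    have hd' := hd
    simp only [C, Set.mem_ofPred_eq] at hd'
    rw [hdi]
    split_ifs at hd' with hi
    · have : inner ℝ (Q.abar i) d = -Q.bbar i := by linarith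
      rw [this]; linarith
    · have hζ0 := h2 (not_lt.1 hi)
      nlinarith
  · have := inner_le_supportFn
      (mem_C_of_orthogonal ha (inner_zero_right _) (t := 0) (fun _ => rfl) le_rfl) y
    refine le_trans (le_of_eq ?_) this
    rw [inner_add_right, inner_add_right, real_inner_smul_right, real_inner_smul_right,
      inner_zero_right, ← hζ]
    congr 1
    ring

/-! ### The dual objective -/

/-- The real-valued data of a dual point with finite dual objective: `S` is the value of the
support function of `X`. -/
structure DualData (Q : QP n m) (u : DualPoint n m) (S : ℝ) : Prop where
  inner_last_le : ∀ d ∈ Q.X, inner ℝ u.last d ≤ S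
  con_eq : ∀ i, u.con i = Q.zeta u i • Q.abar i
  zeta_nonneg : ∀ i : Fin m, Q.mbar ≤ (i : ℕ) → 0 ≤ Q.zeta u i
  D_eq : ∀ ρ, Q.D u ρ = ((-(1 / 2) * quad (Q.H ρ)⁻¹ (u.zero - ρ • Q.g)
    + ∑ i, Q.zeta u i * Q.b i - S : ℝ) : EReal)

/-- Only the real-valued quadratic term depends on `ρ`, so finiteness at one `ρ₀` makes all support
functions finite and gives the formula at every `ρ`. -/
lemma exists_dualData (ha : ∀ i, 0 < ‖Q.a i‖) (hX : Q.X.Nonempty) {u : DualPoint n m} {ρ₀ : ℝ}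
    (h : ⊥ < Q.D u ρ₀) : ∃ S, Q.DualData u S := by
  have hbot : ∀ i ∈ Finset.univ,
      ((‖Q.a i‖ : ℝ) : EReal) * supportFn (Q.C i) (u.con i) ≠ ⊥ := by
    intro i _
    obtain h0 := supportFn_ne_bot (C_nonempty (ha i)) (u.con i)
    by_cases htop : supportFn (Q.C i) (u.con i) = ⊤
    · rw [htop, EReal.coe_mul_top_of_pos (ha i)]; simp
    · rw [← EReal.coe_toReal htop h0, ← EReal.coe_mul]; exact EReal.coe_ne_bot _
  have hD := h.ne'
  rw [D, sub_eq_add_neg, sub_eq_add_neg, Ne, EReal.add_eq_bot_iff, EReal.add_eq_bot_iff,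
    EReal.neg_eq_bot_iff, EReal.neg_eq_bot_iff] at hD
  push Not at hD
  obtain ⟨⟨-, hsum⟩, hlast⟩ := hD
  have hC : ∀ i, supportFn (Q.C i) (u.con i) ≠ ⊤ := fun i htop =>
    ereal_ne_top_of_sum_ne_top hbot hsum (Finset.mem_univ i)
      (by rw [htop, EReal.coe_mul_top_of_pos (ha i)])
  obtain ⟨S, hS, hle⟩ := exists_supportFn_eq_coe hX hlast
  refine ⟨S, hle, fun i => (supportFn_C (ha i) (hC i)).1,
    fun i => (supportFn_C (ha i) (hC i)).2.1, fun ρ => ?_⟩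
  have hterm : ∀ i, ((‖Q.a i‖ : ℝ) : EReal) * supportFn (Q.C i) (u.con i)
      = ((-(Q.zeta u i * Q.b i) : ℝ) : EReal) := by
    intro i
    rw [(supportFn_C (ha i) (hC i)).2.2, ← EReal.coe_mul, ← norm_mul_bbar (ha i), zeta]
    congr 1
    ring
  rw [D, hS, Finset.sum_congr rfl fun i _ => hterm i, ← ereal_coe_sum, ← EReal.coe_sub,
    ← EReal.coe_sub, Finset.sum_neg_distrib, sub_neg_eq_add]

variable {u : DualPoint n m} {S : ℝ}

lemma abs_zeta_le_one (ha : ∀ i, 0 < ‖Q.a i‖) (hu : Q.DualFeasible u) (i : Fin m) :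
    |Q.zeta u i| ≤ 1 := by
  refine (abs_real_inner_le_norm _ _).trans ?_
  rw [norm_abar (ha i), mul_one]
  exact hu.2 i

lemma DualData.sum_eq (ha : ∀ i, 0 < ‖Q.a i‖) (hS : Q.DualData u S) (hu : Q.DualFeasible u) :
    ∑ i, Q.zeta u i • Q.a i = -u.zero - u.last := by
  have h := hu.1
  have h2 : ∑ i, ‖Q.a i‖ • u.con i = ∑ i, Q.zeta u i • Q.a i := by
    refine Finset.sum_congr rfl fun i _ => ?_
    rw [hS.con_eq i, smul_comm, norm_smul_abar (ha i)]
  rw [h2] at h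
  rw [← sub_eq_zero, ← h]
  abel

/-- Weak duality. -/
lemma DualData.D_le (ha : ∀ i, 0 < ‖Q.a i‖) (hS : Q.DualData u S) (hu : Q.DualFeasible u)
    {ρ : ℝ} (hH : (Q.H ρ).PosDef) {d : Vec n} (hd : d ∈ Q.X) :
    (Q.D u ρ).toReal ≤ Q.l d ρ + 1 / 2 * quad (Q.H ρ) d := by
  rw [hS.D_eq, EReal.toReal_coe, l]
  -- Dual feasibility paired with `d` cancels the terms linear in `u`; what remains is the sum of
  -- the support bound, Fenchel-Young and the termwise multiplier bound.
  have h1 := hS.inner_last_le d hd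
  have h2 := congrArg (fun y : Vec n => (inner ℝ y d : ℝ)) (hS.sum_eq ha hu)
  simp only [sum_inner, real_inner_smul_left, inner_sub_left, inner_neg_left] at h2
  have h3 := inner_le_quad_inv_add_quad hH (u.zero - ρ • Q.g) d
  rw [inner_sub_left, real_inner_smul_left] at h3
  have h4 : ∑ i, Q.zeta u i * Q.b i + ∑ i, Q.zeta u i * inner ℝ (Q.a i) d
      ≤ ∑ i, viol Q.mbar i (Q.b i + inner ℝ (Q.a i) d) := by
    rw [← Finset.sum_add_distrib]
    refine Finset.sum_le_sum fun i _ => ?_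
    rw [← mul_add]
    simpa using mul_le_viol (mbar := Q.mbar) (i := i) (t := Q.b i + inner ℝ (Q.a i) d)
      (abs_zeta_le_one ha hu i) (hS.zeta_nonneg i)
  linarith

/-- The quadratic term and `-S` are nonpositive (`S ≥ 0` because `0 ∈ X`). For `Z < 1` this improves
on weak duality at `d = 0` by the factor `Z`. -/
lemma DualData.D_le_mul (hS : Q.DualData u S) (h0 : 0 ∈ Q.X)
    {ρ : ℝ} (hH : (Q.H ρ).PosDef) {Z : ℝ} (hZ : ∀ i, |Q.zeta u i| ≤ Z) :
    (Q.D u ρ).toReal ≤ Z * ∑ i, viol Q.mbar i (Q.b i) := by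
  rw [hS.D_eq, EReal.toReal_coe]
  have h1 := hS.inner_last_le 0 h0
  rw [inner_zero_right] at h1
  have h2 := quad_nonneg hH.inv (u.zero - ρ • Q.g)
  have h3 : ∑ i, Q.zeta u i * Q.b i ≤ Z * ∑ i, viol Q.mbar i (Q.b i) := by
    rw [Finset.mul_sum]
    exact Finset.sum_le_sum fun i _ => mul_le_viol (hZ i) (hS.zeta_nonneg i)
  linarith

/-- Since `ā` is a unit vector, the residual is 1-Lipschitz, and on `C i` it is zero or nonpositive.
-/
lemma abs_residual_le_infDist {i : Fin m} (ha : 0 < ‖Q.a i‖) {d : Vec n}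
    (h : 0 < inner ℝ (Q.abar i) d + Q.bbar i ∨
      (i : ℕ) < Q.mbar ∧ inner ℝ (Q.abar i) d + Q.bbar i < 0) :
    |inner ℝ (Q.abar i) d + Q.bbar i| ≤ Metric.infDist d (Q.C i) := by
  refine (Metric.le_infDist (C_nonempty ha)).2 fun {y} hy => ?_
  have h1 : |(inner ℝ (Q.abar i) (d - y) : ℝ)| ≤ ‖d - y‖ := by
    simpa [norm_abar ha] using abs_real_inner_le_norm (Q.abar i) (d - y)
  rw [inner_sub_right] at h1
  rw [dist_eq_norm]
  refine le_trans ?_ h1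
  simp only [C, Set.mem_ofPred_eq] at hy
  split_ifs at hy with hi
  · apply le_of_eq; congr 1; linarith
  · have hp : 0 < inner ℝ (Q.abar i) d + Q.bbar i := by tauto
    rw [abs_of_pos hp]
    refine le_trans ?_ (le_abs_self _)
    linarith

/-- The complementarity measure dominates the model infeasibility when the multipliers are
small. -/
lemma mul_l_le_chi (ha : ∀ i, 0 < ‖Q.a i‖) {Z : ℝ} (hZ1 : Z ≤ 1)
    (hZ : ∀ i, |Q.zeta u i| ≤ Z) (d : Vec n) : (1 - Z) * Q.l d 0 ≤ Q.chi d u := by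
  rw [l, zero_mul, zero_add, chi, Finset.mul_sum]
  refine Finset.sum_le_sum fun i _ => ?_
  have hres := norm_mul_residual (ha i) d
  set r := inner ℝ (Q.abar i) d + Q.bbar i with hr
  rw [← hres]
  have hn := (ha i).le
  have hz := abs_le.1 (hZ i)
  split_ifs with h1 h2
  · have h3 := abs_residual_le_infDist (ha i) (d := d) (Or.inl h1)
    rw [← hr, abs_of_pos h1] at h3
    have hv : viol Q.mbar i (‖Q.a i‖ * r) = ‖Q.a i‖ * r := by
      have : 0 ≤ ‖Q.a i‖ * r := by positivity
      unfold viol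
      split_ifs
      · exact abs_of_nonneg this
      · exact max_eq_left this
    rw [hv, ← mul_assoc]
    have h5 : 0 ≤ 1 - Z := by linarith
    have h4 : 1 - Z ≤ 1 - Q.zeta u i := by linarith
    gcongr
    exact mul_nonneg (h5.trans h4) hn
  · have h3 := abs_residual_le_infDist (ha i) (d := d) (Or.inr h2)
    rw [← hr] at h3
    have hv : viol Q.mbar i (‖Q.a i‖ * r) = ‖Q.a i‖ * |r| := by
      rw [viol, if_pos h2.1, abs_mul, abs_norm]
    rw [hv, ← mul_assoc]
    have h5 : 0 ≤ 1 - Z := by linarith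
    have h4 : 1 - Z ≤ 1 + Q.zeta u i := by linarith
    gcongr
    exact mul_nonneg (h5.trans h4) hn
  · have : viol Q.mbar i (‖Q.a i‖ * r) = 0 := by
      push Not at h1 h2
      refine viol_eq_zero_of_sat (fun hi => ?_)
        (fun _ => mul_nonpos_of_nonneg_of_nonpos hn h1)
      rw [le_antisymm h1 (h2 hi), mul_zero]
    rw [this, mul_zero]

lemma J_toReal {d : Vec n} (hd : d ∈ Q.X) (ρ : ℝ) :
    (Q.J d ρ).toReal = Q.l d ρ + 1 / 2 * quad (Q.H ρ) d := by
  rw [J, if_pos hd, EReal.toReal_coe]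

lemma l_zero_nonneg (d : Vec n) : 0 ≤ Q.l d 0 := by
  rw [l, zero_mul, zero_add]
  exact Finset.sum_nonneg fun i _ => viol_nonneg _

lemma l_at_zero (ρ : ℝ) : Q.l 0 ρ = ∑ i, viol Q.mbar i (Q.b i) := by
  simp [l]

end QP

/-! ### First-order expansions -/

lemma continuous_gradient {n : ℕ} {h : Vec n → ℝ} (hh : ContDiff ℝ 1 h) :
    Continuous (gradient h) := by
  have h1 : Continuous (fderiv ℝ h) := hh.continuous_fderiv one_ne_zero
  exact (InnerProductSpace.toDual ℝ (Vec n)).symm.continuous.comp h1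

/-- The mean value inequality is used twice: for the gradient, then for `h` minus its linearization
on the segment. The cruder constant `B` instead of `B / 2` suffices. -/
lemma abs_sub_sub_inner_gradient_le {n : ℕ} {h : Vec n → ℝ} {Ω : Set (Vec n)}
    (hΩo : IsOpen Ω) (hΩ : Convex ℝ Ω) (h1 : DifferentiableOn ℝ h Ω)
    (h2 : DifferentiableOn ℝ (gradient h) Ω) {B : ℝ}
    (hB : ∀ x ∈ Ω, ‖fderiv ℝ (gradient h) x‖ ≤ B) {x y : Vec n} (hx : x ∈ Ω) (hy : y ∈ Ω) :
    |h y - h x - inner ℝ (gradient h x) (y - x)| ≤ B * ‖y - x‖ ^ 2 := by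
  have hseg : segment ℝ x y ⊆ Ω := hΩ.segment_subset hx hy
  have hB0 : 0 ≤ B := (norm_nonneg _).trans (hB x hx)
  have hdiff : ∀ w ∈ Ω, DifferentiableAt ℝ h w := fun w hw =>
    (h1 w hw).differentiableAt (hΩo.mem_nhds hw)
  have hbound : ∀ w ∈ segment ℝ x y, ‖fderiv ℝ h w - fderiv ℝ h x‖ ≤ B * ‖y - x‖ := by
    intro w hw
    have h3 : ‖gradient h w - gradient h x‖ ≤ B * ‖w - x‖ :=
      hΩ.norm_image_sub_le_of_norm_fderiv_le
        (fun v hv => (h2 v hv).differentiableAt (hΩo.mem_nhds hv)) hB hx (hseg hw)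
    rw [← toDual_gradient, ← toDual_gradient, ← map_sub, LinearIsometryEquiv.norm_map]
    refine h3.trans ?_
    gcongr
    exact norm_sub_le_of_mem_segment hw
  have := (convex_segment x y).norm_image_sub_le_of_norm_hasFDerivWithin_le'
    (f := h) (f' := fun w => fderiv ℝ h w) (φ := fderiv ℝ h x)
    (fun w hw => (hdiff w (hseg hw)).hasFDerivAt.hasFDerivWithinAt) hbound
    (left_mem_segment ℝ x y) (right_mem_segment ℝ x y)
  rw [inner_gradient_left, ← Real.norm_eq_abs]
  refine this.trans (le_of_eq ?_)
  ring

namespace NLP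

variable {n m : ℕ} (P : NLP n m)

/-- The model of the infeasibility measure at `x`. -/
noncomputable def vModel (x d : Vec n) : ℝ :=
  ∑ i, viol P.mbar i (P.c i x + inner ℝ (gradient (P.c i) x) d)

lemma vModel_zero (x : Vec n) : P.vModel x 0 = P.v x := by
  simp [vModel, v]

lemma v_nonneg (x : Vec n) : 0 ≤ P.v x := Finset.sum_nonneg fun _ _ => viol_nonneg _

lemma continuous_v : Continuous P.v :=
  continuous_finsetSum _ fun i _ => continuous_viol.comp (P.c_smooth i).continuous

lemma continuous_vModel (d : Vec n) : Continuous fun x => P.vModel x d :=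
  continuous_finsetSum _ fun i _ => continuous_viol.comp
    ((P.c_smooth i).continuous.add ((continuous_gradient (P.c_smooth i)).inner continuous_const))

/-- The descent estimate on which the line search rests. -/
lemma phi_step_le {x d : Vec n} {s ρ E : ℝ} (hs : s ∈ Set.Icc (0 : ℝ) 1) (hρ : 0 ≤ ρ)
    (hf : |P.f (x + s • d) - P.f x - inner ℝ (gradient P.f x) (s • d)| ≤ E)
    (hc : ∀ i, |P.c i (x + s • d) - P.c i x - inner ℝ (gradient (P.c i) x) (s • d)| ≤ E) :
    P.phi (x + s • d) ρ - P.phi x ρ ≤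
      -s * (P.v x - (ρ * inner ℝ (gradient P.f x) d + P.vModel x d)) + (ρ + m) * E := by
  have h1 : P.f (x + s • d) ≤ P.f x + s * inner ℝ (gradient P.f x) d + E := by
    have := (abs_le.1 hf).2
    rw [real_inner_smul_right] at this
    linarith
  have h2 : P.v (x + s • d) ≤ (1 - s) * P.v x + s * P.vModel x d + m * E := by
    have : (m : ℝ) * E = ∑ _i : Fin m, E := by simp
    rw [v, v, vModel, Finset.mul_sum, Finset.mul_sum, this, ← Finset.sum_add_distrib,
      ← Finset.sum_add_distrib]
    refine Finset.sum_le_sum fun i _ => ?_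
    set q : ℝ := inner ℝ (gradient (P.c i) x) d with hq
    -- The linearized constraint at `s d` is the convex combination of its values at `0` and `d`, so
    -- convexity of the penalty term applies.
    have h3 := viol_le_add_abs (mbar := P.mbar) (i := i) (P.c i (x + s • d))
      ((1 - s) • P.c i x + s • (P.c i x + q))
    have h4 := (convexOn_viol (mbar := P.mbar) (i := i)).2 (Set.mem_univ (P.c i x))
      (Set.mem_univ (P.c i x + q)) (sub_nonneg.2 hs.2) hs.1 (by ring)
    have h5 := hc i
    rw [real_inner_smul_right, ← hq] at h5
    have h6 : P.c i (x + s • d) - ((1 - s) • P.c i x + s • (P.c i x + q))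
        = P.c i (x + s • d) - P.c i x - s * q := by
      simp only [smul_eq_mul]; ring
    rw [h6] at h3
    simp only [smul_eq_mul] at h3 h4
    linarith
  have h3 := mul_le_mul_of_nonneg_left h1 hρ
  rw [phi, phi]
  linarith

/-! ### Stationarity for the infeasibility measure -/

lemma convexOn_vModel_line (x d : Vec n) :
    ConvexOn ℝ Set.univ fun t : ℝ => P.vModel x (t • d) := by
  refine ⟨convex_univ, fun s _ t _ p q hp hq hpq => ?_⟩
  simp only [vModel, smul_eq_mul, Finset.mul_sum, ← Finset.sum_add_distrib]
  refine Finset.sum_le_sum fun i _ => ?_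
  have h := (convexOn_viol (mbar := P.mbar) (i := i)).2
    (Set.mem_univ (P.c i x + inner ℝ (gradient (P.c i) x) (s • d)))
    (Set.mem_univ (P.c i x + inner ℝ (gradient (P.c i) x) (t • d))) hp hq hpq
  simp only [smul_eq_mul] at h
  refine le_trans (le_of_eq ?_) h
  congr 1
  simp only [real_inner_smul_right]
  have : P.c i x = (p + q) * P.c i x := by rw [hpq, one_mul]
  linear_combination this

/-- Along a ray the model is convex, so it has a right derivative `L` at `0`, and `v` differs from
the model by `o(t)`. At `t d` the hypothesis bounds the difference quotient of the model below by
`-K t ‖d‖²`, whence `L ≥ 0`. -/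
lemma stationaryForViolation_of_le {x : Vec n} {X : Set (Vec n)} (hX : 0 ∈ interior X) {K : ℝ}
    (h : ∀ d ∈ X, P.v x ≤ P.vModel x d + K * ‖d‖ ^ 2) : P.StationaryForViolation x := by
  intro d
  have hder := (P.convexOn_vModel_line x d).hasDerivWithinAt_rightDeriv_of_mem_interior
    (x := 0) (by simp)
  set L := derivWithin (fun t : ℝ => P.vModel x (t • d)) (Set.Ioi 0) 0
  have hslope := (hasDerivWithinAt_iff_tendsto_slope' (by simp)).1 hder
  have hslope_eq : ∀ t : ℝ, slope (fun t : ℝ => P.vModel x (t • d)) 0 t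
      = (P.vModel x (t • d) - P.v x) / t := by
    intro t
    rw [slope_def_field, zero_smul, vModel_zero, sub_zero]
  replace hslope := hslope.congr hslope_eq
  refine ⟨L, ?_, ?_⟩
  · have hlow : Tendsto (fun t : ℝ => -(K * ‖d‖ ^ 2 * t)) (𝓝[>] 0) (𝓝 0) := by
      have : Continuous fun t : ℝ => -(K * ‖d‖ ^ 2 * t) := by fun_prop
      simpa using (this.tendsto 0).mono_left nhdsWithin_le_nhds
    refine le_of_tendsto_of_tendsto hlow hslope ?_
    have hmem : ∀ᶠ t : ℝ in 𝓝[>] 0, t • d ∈ X := by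
      have hc : Continuous fun t : ℝ => t • d := by fun_prop
      have := (hc.tendsto 0).eventually
        (by rw [zero_smul]; exact mem_interior_iff_mem_nhds.1 hX : ∀ᶠ y in 𝓝 ((0 : ℝ) • d), y ∈ X)
      exact this.filter_mono nhdsWithin_le_nhds
    filter_upwards [hmem, self_mem_nhdsWithin] with t ht ht0
    have ht0 : 0 < t := ht0
    have := h _ ht
    rw [norm_smul, mul_pow, Real.norm_eq_abs, sq_abs] at this
    rw [le_div_iff₀ ht0]
    linarith
  · have herr : Tendsto (fun t : ℝ => ∑ i, |(P.c i (x + t • d) - P.c i x) / t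
        - inner ℝ (gradient (P.c i) x) d|) (𝓝[>] 0) (𝓝 0) := by
      suffices h : ∀ i ∈ Finset.univ, Tendsto (fun t : ℝ => |(P.c i (x + t • d) - P.c i x) / t
          - inner ℝ (gradient (P.c i) x) d|) (𝓝[>] 0) (𝓝 0) by
        simpa using tendsto_finsetSum _ h
      intro i _
      have h1 : HasLineDerivAt ℝ (P.c i) (fderiv ℝ (P.c i) x d) x d :=
        ((P.c_smooth i).differentiable one_ne_zero x).hasFDerivAt.hasLineDerivAt d
      have h2 := (hasDerivWithinAt_iff_tendsto_slope' (s := Set.Ioi (0 : ℝ)) (by simp)).1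
        (HasDerivAt.hasDerivWithinAt h1)
      rw [← inner_gradient_left] at h2
      have h3 := (h2.sub_const (inner ℝ (gradient (P.c i) x) d)).abs
      rw [sub_self, abs_zero] at h3
      refine h3.congr fun t => ?_
      rw [slope_def_field, zero_smul, add_zero, sub_zero]
    have hdiff : Tendsto (fun t : ℝ => (P.v (x + t • d) - P.v x) / t
        - (P.vModel x (t • d) - P.v x) / t) (𝓝[>] 0) (𝓝 0) := by
      refine squeeze_zero_norm' ?_ herr
      filter_upwards [self_mem_nhdsWithin] with t ht0
      have ht0 : 0 < t := ht0
      have h1 : |P.v (x + t • d) - P.vModel x (t • d)| ≤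
          ∑ i, |P.c i (x + t • d) - P.c i x - t * inner ℝ (gradient (P.c i) x) d| := by
        rw [v, vModel, ← Finset.sum_sub_distrib]
        refine (Finset.abs_sum_le_sum_abs _ _).trans (Finset.sum_le_sum fun i _ => ?_)
        have e1 := viol_le_add_abs (mbar := P.mbar) (i := i) (P.c i (x + t • d))
          (P.c i x + inner ℝ (gradient (P.c i) x) (t • d))
        have e2 := viol_le_add_abs (mbar := P.mbar) (i := i)
          (P.c i x + inner ℝ (gradient (P.c i) x) (t • d)) (P.c i (x + t • d))
        rw [abs_sub_comm] at e2
        rw [real_inner_smul_right, ← sub_sub] at *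
        exact abs_sub_le_iff.2 ⟨by linarith, by linarith⟩
      rw [Real.norm_eq_abs, ← sub_div, sub_sub_sub_cancel_right, abs_div, abs_of_pos ht0,
        div_le_iff₀ ht0, Finset.sum_mul]
      refine h1.trans (le_of_eq (Finset.sum_congr rfl fun i _ => ?_))
      rw [← abs_of_pos ht0, ← abs_mul, abs_of_pos ht0]
      congr 1
      field_simp
    have := hslope.add hdiff
    rw [add_zero] at this
    refine this.congr fun t => ?_
    ring

/-! ### The constraint qualification -/

/-- Under the MFCQ the only multiplier of the feasibility problem is zero. -/
lemma MFCQ.eq_zero {P : NLP n m} {z : Vec n} (h : P.MFCQ z) {ζ : Fin m → ℝ}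
    (hpos : ∀ i : Fin m, P.mbar ≤ (i : ℕ) → 0 ≤ ζ i)
    (hsum : ∑ i, ζ i • gradient (P.c i) z = 0) (hc : 0 ≤ ∑ i, ζ i * P.c i z) : ζ = 0 := by
  obtain ⟨-, hli, d, hE, hI⟩ := h
  have h1 := congrArg (fun y : Vec n => (inner ℝ y d : ℝ)) hsum
  simp only [sum_inner, real_inner_smul_left, inner_zero_left] at h1
  -- The terms are nonpositive with nonnegative sum, so each vanishes. Strictness kills the
  -- inequality multipliers, linear independence the others.
  have hterm : ∀ i ∈ Finset.univ,
      ζ i * (P.c i z + inner ℝ (gradient (P.c i) z) d) ≤ 0 := by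
    intro i _
    by_cases hi : (i : ℕ) < P.mbar
    · rw [hE i hi, mul_zero]
    · exact mul_nonpos_of_nonneg_of_nonpos (hpos i (not_lt.1 hi)) (hI i (not_lt.1 hi)).le
  have h2 : ∑ i, ζ i * (P.c i z + inner ℝ (gradient (P.c i) z) d) = 0 := by
    refine le_antisymm (Finset.sum_nonpos hterm) ?_
    simp only [mul_add, Finset.sum_add_distrib, h1, add_zero]
    exact hc
  have hI0 : ∀ i : Fin m, ¬ (i : ℕ) < P.mbar → ζ i = 0 := by
    intro i hi
    have := (Finset.sum_eq_zero_iff_of_nonpos hterm).1 h2 i (Finset.mem_univ i)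
    exact (mul_eq_zero.1 this).resolve_right (hI i (not_lt.1 hi)).ne
  have h3 : ∑ i : {i : Fin m // (i : ℕ) < P.mbar}, ζ i • gradient (P.c i) z = 0 := by
    rw [← hsum, ← Fintype.sum_subtype_add_sum_subtype (fun i : Fin m => (i : ℕ) < P.mbar)]
    rw [left_eq_add]
    exact Finset.sum_eq_zero fun i _ => by rw [hI0 i i.2, zero_smul]
  have h4 := Fintype.linearIndependent_iff.1 hli (fun i => ζ i) h3
  funext i
  by_cases hi : (i : ℕ) < P.mbar
  · exact h4 ⟨i, hi⟩
  · exact hI0 i hi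

end NLP

namespace Iterates

variable {n m : ℕ} {it : Iterates n m} {P : NLP n m} {X : Set (Vec n)} {par : Params}

/-! ### Penalty parameters -/

lemma IsRun.rhoIn_mem (h : it.IsRun P X par) {k : ℕ} (hk : 0 < it.rhoPrev k) :
    ∀ j ≤ it.jEnd k, 0 < it.rhoIn k j ∧ it.rhoIn k j ≤ it.rhoPrev k := by
  intro j
  induction j with
  | zero => intro _; rw [h.rhoIn_zero]; exact ⟨hk, le_rfl⟩
  | succ j ih =>
    intro hj
    obtain ⟨h1, h2⟩ := ih (by lia)
    have hlt : j < it.jEnd k := by lia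
    by_cases hR : it.RedPhi P X par k j ∧ it.RedC P X par k j
    · have hV : ¬ it.RedV P X par k j := fun hV => h.not_stopped k j hlt ⟨hR.1, hR.2, hV⟩
      rw [h.rhoIn_reduce k j hlt hR.1 hR.2 hV]
      obtain ⟨t1, t2⟩ := par.thetaRho_mem
      exact ⟨by positivity, (mul_le_of_le_one_left h1.le t2.le).trans h2⟩
    · rw [h.rhoIn_keep k j hlt hR]
      exact ⟨h1, h2⟩

lemma IsRun.rho_mem_of_pos (h : it.IsRun P X par) {k : ℕ} (hk : 0 < it.rhoPrev k) :
    0 < it.rho k ∧ it.rho k ≤ it.rhoTilde k := by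
  by_cases hP : it.Posterior P X par k (it.rhoTilde k)
  · rw [h.rho_keep k hP]
    exact ⟨(h.rhoIn_mem hk _ le_rfl).1, le_rfl⟩
  · exact ⟨(h.rho_reduce k hP).1, (h.rho_reduce k hP).2.1⟩

lemma IsRun.rhoPrev_pos (h : it.IsRun P X par) (k : ℕ) : 0 < it.rhoPrev k := by
  induction k with
  | zero => exact h.rhoInit_pos
  | succ k ih => exact (h.rho_mem_of_pos ih).1

lemma IsRun.rho_pos (h : it.IsRun P X par) (k : ℕ) : 0 < it.rho k :=
  (h.rho_mem_of_pos (h.rhoPrev_pos k)).1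

lemma IsRun.rho_le_rhoTilde (h : it.IsRun P X par) (k : ℕ) : it.rho k ≤ it.rhoTilde k :=
  (h.rho_mem_of_pos (h.rhoPrev_pos k)).2

lemma IsRun.rhoTilde_le (h : it.IsRun P X par) (k : ℕ) : it.rhoTilde k ≤ it.rhoPrev k :=
  (h.rhoIn_mem (h.rhoPrev_pos k) _ le_rfl).2

lemma IsRun.antitone_rho (h : it.IsRun P X par) : Antitone it.rho :=
  antitone_nat_of_succ_le fun k => (h.rho_le_rhoTilde (k + 1)).trans (h.rhoTilde_le (k + 1))

lemma IsRun.omega_pos (h : it.IsRun P X par) : ∀ k, 0 < it.omega k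
  | 0 => h.omega_zero_pos
  | k + 1 => (h.omega_succ k).1

lemma IsRun.tendsto_omega (h : it.IsRun P X par) : Tendsto it.omega atTop (𝓝 0) := by
  obtain ⟨t1, t2⟩ := par.thetaOmega_mem
  have hle : ∀ k, it.omega k ≤ par.thetaOmega ^ k * it.omega 0 := by
    intro k
    induction k with
    | zero => simp
    | succ k ih =>
      refine (h.omega_succ k).2.trans ?_
      rw [pow_succ', mul_assoc]
      gcongr
  refine squeeze_zero (fun k => (h.omega_pos k).le) hle ?_
  simpa using (tendsto_pow_atTop_nhds_zero_of_lt_one t1.le t2).mul_const (it.omega 0)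

lemma IsRun.posDef_in (h : it.IsRun P X par) {k j : ℕ} (hj : j ≤ it.jEnd k) :
    ((it.qp P X k).H (it.rhoIn k j)).PosDef :=
  h.H_posDef k _ ⟨(h.rhoIn_mem (h.rhoPrev_pos k) j hj).1.le, (h.rhoIn_mem (h.rhoPrev_pos k) j hj).2⟩

lemma IsRun.posDef_zero (h : it.IsRun P X par) (k : ℕ) : ((it.qp P X k).H 0).PosDef :=
  h.H_posDef k 0 ⟨le_rfl, (h.rhoPrev_pos k).le⟩

/-! ### The subproblems -/

lemma l_zero_eq (k : ℕ) (ρ : ℝ) : (it.qp P X k).l 0 ρ = P.v (it.x k) := QP.l_at_zero ρ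

lemma l_eq (k : ℕ) (d : Vec n) (ρ : ℝ) : (it.qp P X k).l d ρ =
    ρ * inner ℝ (gradient P.f (it.x k)) d + P.vModel (it.x k) d := rfl

lemma l_eq_vModel (k : ℕ) (d : Vec n) : (it.qp P X k).l d 0 = P.vModel (it.x k) d := by
  rw [l_eq, zero_mul, zero_add]

lemma dl_eq (k : ℕ) (d : Vec n) (ρ : ℝ) : (it.qp P X k).dl d ρ =
    P.v (it.x k) - (ρ * inner ℝ (gradient P.f (it.x k)) d + P.vModel (it.x k) d) := by
  rw [QP.dl, l_zero_eq, l_eq]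

lemma IsRun.half_quad_le_dl (h : it.IsRun P X par) (h0 : (0 : Vec n) ∈ X) {k j : ℕ}
    (hj : j ≤ it.jEnd k) : 1 / 2 * quad ((it.qp P X k).H (it.rhoIn k j)) (it.dIn k j) ≤
      (it.qp P X k).dl (it.dIn k j) (it.rhoIn k j) := by
  have h1 := h.primal_le k j hj
  have hd : it.dIn k j ∈ (it.qp P X k).X := h.primal_mem k j hj
  have h0' : (0 : Vec n) ∈ (it.qp P X k).X := h0
  rw [QP.J, QP.J, if_pos hd, if_pos h0', EReal.coe_le_coe_iff, quad_zero] at h1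
  rw [QP.dl]
  linarith

/-! ### Weak duality and the acceptance ratios at inner iterations -/

section Dual

variable (h : it.IsRun P X par) (ha : ∀ k i, 0 < ‖gradient (P.c i) (it.x k)‖)
  (h0 : (0 : Vec n) ∈ X) {k j : ℕ} (hj : j ≤ it.jEnd k)
include h ha h0 hj

lemma IsRun.exists_dualData_u : ∃ S, (it.qp P X k).DualData (it.uIn k j) S := by
  have h1 : ∀ i, 0 < ‖(it.qp P X k).a i‖ := ha k
  have h2 : (it.qp P X k).X.Nonempty := ⟨0, h0⟩
  have h3 : ⊥ < (it.qp P X k).D (it.uIn k j) 0 :=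
    lt_of_lt_of_le (h.dual_finite k) (h.dual_u_ge k j hj)
  exact QP.exists_dualData h1 h2 h3

lemma IsRun.exists_dualData_w : ∃ S, (it.qp P X k).DualData (it.wIn k j) S := by
  have h1 : ∀ i, 0 < ‖(it.qp P X k).a i‖ := ha k
  have h2 : (it.qp P X k).X.Nonempty := ⟨0, h0⟩
  have h3 : ⊥ < (it.qp P X k).D (it.wIn k j) 0 :=
    lt_of_lt_of_le (lt_of_lt_of_le (h.dual_finite k) (h.dual_u_ge k j hj)) (h.dual_w_ge k j hj)
  exact QP.exists_dualData h1 h2 h3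

lemma IsRun.D_u_le : ((it.qp P X k).D (it.uIn k j) (it.rhoIn k j)).toReal ≤ P.v (it.x k) := by
  obtain ⟨S, hS⟩ := h.exists_dualData_u ha h0 hj
  have h1 : ∀ i, 0 < ‖(it.qp P X k).a i‖ := ha k
  have h2 : (0 : Vec n) ∈ (it.qp P X k).X := h0
  have := hS.D_le h1 (h.u_feasible k j hj) (h.posDef_in hj) h2
  rwa [l_zero_eq, quad_zero, mul_zero, add_zero] at this

lemma IsRun.D_w_le {d : Vec n} (hd : d ∈ X) :
    ((it.qp P X k).D (it.wIn k j) 0).toReal ≤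
      P.vModel (it.x k) d + 1 / 2 * quad ((it.qp P X k).H 0) d := by
  obtain ⟨S, hS⟩ := h.exists_dualData_w ha h0 hj
  have h1 : ∀ i, 0 < ‖(it.qp P X k).a i‖ := ha k
  have h2 : d ∈ (it.qp P X k).X := hd
  have := hS.D_le h1 (h.w_feasible k j hj) (h.posDef_zero k) h2
  rwa [l_eq_vModel] at this

/-- Weak duality at `d = 0` together with `ω > 0`; this makes the denominator in (Rv) positive. -/
lemma IsRun.max_D_w_lt : max ((it.qp P X k).D (it.wIn k j) 0).toReal 0 <
    (it.qp P X k).Jomega (it.omega k) := by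
  have h1 := h.D_w_le ha h0 hj h0
  rw [NLP.vModel_zero, quad_zero, mul_zero, add_zero] at h1
  have h2 := P.v_nonneg (it.x k)
  have h3 := h.omega_pos k
  have h4 : (it.qp P X k).Jomega (it.omega k) = P.v (it.x k) + it.omega k := rfl
  rw [h4]
  exact max_lt (by linarith) (by linarith)

lemma IsRun.redV_iff : it.RedV P X par k j ↔
    par.betaV * (P.v (it.x k) + it.omega k
      - max ((it.qp P X k).D (it.wIn k j) 0).toReal 0) ≤
    P.v (it.x k) + it.omega k - P.vModel (it.x k) (it.dIn k j) := by
  have h1 := h.max_D_w_lt ha h0 hj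
  rw [RedV, QP.rv, le_div_iff₀ (sub_pos.2 h1), l_eq_vModel]
  rfl

lemma IsRun.redPhi_iff : it.RedPhi P X par k j ↔
    par.betaPhi * (P.v (it.x k) + it.omega k
      - ((it.qp P X k).D (it.uIn k j) (it.rhoIn k j)).toReal) ≤
    (it.qp P X k).dl (it.dIn k j) (it.rhoIn k j) + it.omega k
      - 1 / 2 * quad ((it.qp P X k).H (it.rhoIn k j)) (it.dIn k j) := by
  have h1 := h.D_u_le ha h0 hj
  have h3 := h.omega_pos k
  have h4 : (it.qp P X k).Jomega (it.omega k) = P.v (it.x k) + it.omega k := rfl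
  have hd : it.dIn k j ∈ (it.qp P X k).X := h.primal_mem k j hj
  rw [RedPhi, QP.rphi, h4, le_div_iff₀ (by linarith), QP.J_toReal hd, QP.dl, l_zero_eq]
  constructor <;> intro h' <;> linarith

/-- If the penalty parameter is reduced in the inner loop, the multipliers are bounded away
from zero. -/
lemma IsRun.exists_zeta_gt_of_reducing (hC : it.RedC P X par k j) (hV : ¬ it.RedV P X par k j) :
    ∃ i, par.betaV < |(it.qp P X k).zeta (it.uIn k j) i| := by
  by_contra! hno
  rw [h.redV_iff ha h0 hj, not_le] at hV
  obtain ⟨b1, b2⟩ := par.betaV_mem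
  -- One factor `1 - β_v` of the square in (Rc) cancels, leaving `l(d, 0) ≤ (1 - β_v) J_ω`, which
  -- implies (Rv).
  have h1 := QP.mul_l_le_chi (Q := it.qp P X k) (ha k) b2.le hno (it.dIn k j)
  rw [l_eq_vModel] at h1
  have h2 : (1 - par.betaV) * P.vModel (it.x k) (it.dIn k j) ≤
      (1 - par.betaV) ^ 2 * (P.v (it.x k) + it.omega k) := h1.trans hC
  rw [sq, mul_assoc] at h2
  have h3 := le_of_mul_le_mul_left h2 (by linarith)
  have h4 : 0 ≤ par.betaV * max ((it.qp P X k).D (it.wIn k j) 0).toReal 0 := by positivity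
  linarith

end Dual

/-- If the penalty parameter is reduced after the inner loop, the multipliers are bounded away
from zero. -/
lemma IsRun.exists_zeta_gt_of_not_posterior (h : it.IsRun P X par)
    (ha : ∀ k i, 0 < ‖gradient (P.c i) (it.x k)‖) (h0 : (0 : Vec n) ∈ X) {k : ℕ}
    (hP : ¬ it.Posterior P X par k (it.rhoTilde k)) :
    ∃ i, par.betaV < |(it.qp P X k).zeta (it.uIn k (it.jEnd k)) i| := by
  by_contra! hno
  have hj := le_refl (it.jEnd k)
  have h1 := (h.redPhi_iff ha h0 hj).1 (h.stopped k).1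
  rw [Posterior, not_le] at hP
  obtain ⟨S, hS⟩ := h.exists_dualData_u ha h0 hj
  have h2 := hS.D_le_mul h0 (h.posDef_in hj) hno
  have h3 : (∑ i, viol (it.qp P X k).mbar i ((it.qp P X k).b i)) = P.v (it.x k) := rfl
  rw [h3] at h2
  have h4 := quad_nonneg (h.posDef_in hj) (it.dIn k (it.jEnd k))
  obtain ⟨b1, b2⟩ := par.betaV_mem
  obtain ⟨p1, p2⟩ := par.betaPhi_mem
  obtain ⟨l1, l2⟩ := par.betaL_mem
  have h5 : (it.qp P X k).dl (it.d k) 0 ≤ P.v (it.x k) := by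
    rw [QP.dl, l_zero_eq]
    linarith [QP.l_zero_nonneg (Q := it.qp P X k) (it.d k)]
  have hJ : 0 < P.v (it.x k) + it.omega k := by linarith [P.v_nonneg (it.x k), h.omega_pos k]
  have h6 : par.betaL * ((it.qp P X k).dl (it.d k) 0 + it.omega k) ≤
      par.betaPhi * (1 - par.betaV) * (P.v (it.x k) + it.omega k) :=
    (mul_le_mul_of_nonneg_left (by linarith) l1.le).trans
      (mul_le_mul_of_nonneg_right l2 hJ.le)
  -- (Rphi), the failed test and `β_l ≤ β_φ (1 - β_v)` give `D(u, ρ) > β_v (v + ω)`, against `D(u,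
  -- ρ) ≤ β_v v`.
  have h7 : par.betaPhi * (P.v (it.x k) + it.omega k
      - ((it.qp P X k).D (it.uIn k (it.jEnd k)) (it.rhoIn k (it.jEnd k))).toReal) <
      par.betaPhi * ((1 - par.betaV) * (P.v (it.x k) + it.omega k)) := by
    have : (it.qp P X k).dl (it.d k) (it.rhoTilde k) =
      (it.qp P X k).dl (it.dIn k (it.jEnd k)) (it.rhoIn k (it.jEnd k)) := rfl
    linarith
  have h8 := lt_of_mul_lt_mul_left h7 p1.le
  have h9 := mul_pos b1 (h.omega_pos k)
  linarith

lemma IsRun.exists_zeta_gt (h : it.IsRun P X par)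
    (ha : ∀ k i, 0 < ‖gradient (P.c i) (it.x k)‖) (h0 : (0 : Vec n) ∈ X) {k : ℕ}
    (hk : k ∈ it.setD P X par ∪ it.setT) : ∃ j ≤ it.jEnd k, it.RedPhi P X par k j ∧
      ∃ i, par.betaV < |(it.qp P X k).zeta (it.uIn k j) i| := by
  rcases hk with ⟨j, hj, hR, hC, hV⟩ | hk
  · exact ⟨j, hj, hR, h.exists_zeta_gt_of_reducing ha h0 hj hC hV⟩
  · refine ⟨_, le_rfl, (h.stopped k).1, h.exists_zeta_gt_of_not_posterior ha h0 fun hP => ?_⟩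
    have hk : it.rho k < it.rhoTilde k := hk
    exact hk.ne (h.rho_keep k hP)

end Iterates

/-- Test with `d = r y / ‖y‖`. Through this bound the support term of `X` controls `u^{m+1}`. -/
lemma mul_norm_le_of_inner_le {n : ℕ} {X : Set (Vec n)} {r S : ℝ} (hr : 0 ≤ r)
    (hX : Metric.closedBall (0 : Vec n) r ⊆ X) {y : Vec n} (h : ∀ d ∈ X, inner ℝ y d ≤ S) :
    r * ‖y‖ ≤ S := by
  by_cases hy : y = 0
  · simpa [hy] using h 0 (hX (by simpa using hr))
  · have hy' : ‖y‖ ≠ 0 := norm_ne_zero_iff.2 hy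
    have := h ((r * ‖y‖⁻¹) • y) (hX (by
      rw [mem_closedBall_zero_iff, norm_smul, norm_mul, norm_inv, norm_norm, mul_assoc,
        inv_mul_cancel₀ hy', mul_one, Real.norm_of_nonneg hr]))
    rw [real_inner_smul_right, real_inner_self_eq_norm_sq] at this
    refine le_trans (le_of_eq ?_) this
    field_simp

namespace Iterates

variable {n m : ℕ} {it : Iterates n m} {P : NLP n m} {X : Set (Vec n)} {par : Params}

/-! ### Multipliers near a feasible point -/

/-- An upper bound for the negative dual objective plus the infeasibility at inner iterations with
sufficient reduction of the penalty model. -/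
noncomputable def gapBound (it : Iterates n m) (P : NLP n m) (par : Params) (M : ℝ) (k : ℕ) : ℝ :=
  P.v (it.x k) + (P.v (it.x k) + it.omega k + it.rhoPrev k * M) / par.betaPhi

/-- (Rphi) bounds `D(u, ρ)` below by `v - E`, where `E` is the gap bound, while the multiplier sum
is at most `v`. So half the quadratic term plus the support term is at most `E`; these control `u⁰ -
ρ g` and `u^{m+1}`, and dual feasibility expresses `∑ ζ_i ∇c_i` through them. -/
lemma IsRun.multiplier_estimate (h : it.IsRun P X par)
    (ha : ∀ k i, 0 < ‖gradient (P.c i) (it.x k)‖) {r hi R B : ℝ} (hr : 0 < r)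
    (hball : Metric.closedBall 0 r ⊆ X) (hR : ∀ d ∈ X, ‖d‖ ≤ R) (hhi : 0 < hi)
    {k j : ℕ} (hj : j ≤ it.jEnd k)
    (hspec : ∀ s ∈ spectrum ℝ ((it.qp P X k).H (it.rhoIn k j)), s ≤ hi)
    (hg : ‖gradient P.f (it.x k)‖ ≤ B) (hRed : it.RedPhi P X par k j) :
    (∀ i : Fin m, P.mbar ≤ (i : ℕ) → 0 ≤ (it.qp P X k).zeta (it.uIn k j) i) ∧
    -it.gapBound P par (B * R) k ≤ ∑ i, (it.qp P X k).zeta (it.uIn k j) i * P.c i (it.x k) ∧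
    ‖∑ i, (it.qp P X k).zeta (it.uIn k j) i • gradient (P.c i) (it.x k)‖ ≤
      √(2 * hi * it.gapBound P par (B * R) k) + it.rhoPrev k * B
        + it.gapBound P par (B * R) k / r := by
  have h0 : (0 : Vec n) ∈ X := hball (Metric.mem_closedBall_self hr.le)
  have ha' : ∀ i, 0 < ‖(it.qp P X k).a i‖ := ha k
  have hu := h.u_feasible k j hj
  obtain ⟨S, hS⟩ := h.exists_dualData_u ha h0 hj
  have hpd := h.posDef_in hj
  obtain ⟨hρ0, hρ⟩ := h.rhoIn_mem (h.rhoPrev_pos k) j hj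
  obtain ⟨p1, p2⟩ := par.betaPhi_mem
  have hB : 0 ≤ B := (norm_nonneg _).trans hg
  set E := it.gapBound P par (B * R) k with hE
  set ζ := (it.qp P X k).zeta (it.uIn k j) with hζ
  set ρ := it.rhoIn k j with hρdef
  set u := it.uIn k j with hudef
  have hlast := mul_norm_le_of_inner_le hr.le hball hS.inner_last_le
  have hquad := norm_sq_le_quad_inv hhi hpd hspec (u.zero - ρ • gradient P.f (it.x k))
  have hsum : ∑ i, ζ i * P.c i (it.x k) ≤ P.v (it.x k) := by
    refine Finset.sum_le_sum fun i _ => ?_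
    simpa using mul_le_viol (mbar := P.mbar) (i := i) (t := P.c i (it.x k))
      (QP.abs_zeta_le_one ha' hu i) (hS.zeta_nonneg i)
  have hD : -(E - P.v (it.x k)) ≤ ((it.qp P X k).D u ρ).toReal := by
    have h1 := (h.redPhi_iff ha h0 hj).1 hRed
    have h2 := quad_nonneg hpd (it.dIn k j)
    have h3 : -(it.rhoPrev k * (B * R)) ≤ ρ * inner ℝ (gradient P.f (it.x k)) (it.dIn k j) := by
      have hin : |(inner ℝ (gradient P.f (it.x k)) (it.dIn k j) : ℝ)| ≤ B * R := by
        refine (abs_real_inner_le_norm _ _).trans ?_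
        have := hR _ (h.primal_mem k j hj)
        gcongr
      have hBR : 0 ≤ B * R := (abs_nonneg _).trans hin
      have h5 : ρ * (B * R) ≤ it.rhoPrev k * (B * R) := by gcongr
      have h6 := mul_le_mul_of_nonneg_left (neg_le_of_abs_le hin) hρ0.le
      linarith
    have h4 : 0 ≤ P.vModel (it.x k) (it.dIn k j) :=
      Finset.sum_nonneg fun _ _ => viol_nonneg _
    rw [dl_eq] at h1
    have h5 : P.v (it.x k) + it.omega k - ((it.qp P X k).D u ρ).toReal ≤
        (P.v (it.x k) + it.omega k + it.rhoPrev k * (B * R)) / par.betaPhi := by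
      rw [le_div_iff₀ p1]
      linarith
    have h6 := P.v_nonneg (it.x k)
    have h7 := h.omega_pos k
    rw [hE, gapBound]
    linarith
  rw [hS.D_eq, EReal.toReal_coe] at hD
  have hqz := quad_nonneg hpd.inv (u.zero - ρ • gradient P.f (it.x k))
  have hv := P.v_nonneg (it.x k)
  have hgdef : (it.qp P X k).g = gradient P.f (it.x k) := rfl
  have hbdef : ∑ i, (it.qp P X k).zeta u i * (it.qp P X k).b i
    = ∑ i, ζ i * P.c i (it.x k) := rfl
  rw [hgdef, hbdef] at hD
  have hrl : 0 ≤ r * ‖u.last‖ := by positivity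
  refine ⟨hS.zeta_nonneg, by linarith, ?_⟩
  have hz : ‖u.zero - ρ • gradient P.f (it.x k)‖ ≤ √(2 * hi * E) := by
    apply Real.le_sqrt_of_sq_le
    refine hquad.trans ?_
    have : quad ((it.qp P X k).H ρ)⁻¹ (u.zero - ρ • gradient P.f (it.x k)) ≤ 2 * E := by linarith
    calc _ ≤ hi * (2 * E) := by gcongr
      _ = _ := by ring
  have hl : ‖u.last‖ ≤ E / r := by
    rw [le_div_iff₀ hr]; linarith
  have hρg : ‖ρ • gradient P.f (it.x k)‖ ≤ it.rhoPrev k * B := by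
    rw [norm_smul, Real.norm_of_nonneg hρ0.le]
    exact mul_le_mul hρ hg (norm_nonneg _) (h.rhoPrev_pos k).le
  have hs : ∑ i, ζ i • gradient (P.c i) (it.x k) = -u.zero - u.last := hS.sum_eq ha' hu
  rw [hs]
  calc ‖-u.zero - u.last‖ = ‖(u.zero - ρ • gradient P.f (it.x k))
        + ρ • gradient P.f (it.x k) + u.last‖ := by rw [← norm_neg]; congr 1; abel
    _ ≤ ‖u.zero - ρ • gradient P.f (it.x k)‖ + ‖ρ • gradient P.f (it.x k)‖ + ‖u.last‖ :=
        norm_add₃_le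
    _ ≤ _ := by gcongr

/-- At a limit point of iterations with sufficient reduction of the penalty model and multipliers
bounded away from zero, the MFCQ fails. -/
lemma IsRun.not_MFCQ (h : it.IsRun P X par) (hG : GlobalAssumption P X it)
    (hrho : Tendsto it.rho atTop (𝓝 0)) {z : Vec n} {s : ℕ → ℕ} (hs : StrictMono s)
    (hx : Tendsto (fun i => it.x (s i)) atTop (𝓝 z)) {j : ℕ → ℕ}
    (hj : ∀ i, j i ≤ it.jEnd (s i)) (hRed : ∀ i, it.RedPhi P X par (s i) (j i))
    (hζ : ∀ i, ∃ p, par.betaV < |(it.qp P X (s i)).zeta (it.uIn (s i) (j i)) p|) :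
    ¬ P.MFCQ z := by
  intro hM
  have ha := hG.gradient_pos
  obtain ⟨r, hr, hball⟩ := Metric.nhds_basis_closedBall.mem_iff.1
    (mem_interior_iff_mem_nhds.1 hG.zero_mem_interior)
  obtain ⟨R, hR⟩ := hG.X_compact.isBounded.exists_norm_le
  obtain ⟨lo, hi, hlo, hlohi, hspec⟩ := hG.eigenvalues
  obtain ⟨Ω, -, -, hmem, ⟨-, -, B, hB⟩, -⟩ := hG.smooth
  have hhi := hlo.trans_le hlohi
  set ζ : ℕ → Fin m → ℝ := fun i => (it.qp P X (s i)).zeta (it.uIn (s i) (j i)) with hζdef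
  have hest : ∀ᶠ i in atTop, (∀ p : Fin m, P.mbar ≤ (p : ℕ) → 0 ≤ ζ i p) ∧
      -it.gapBound P par (B * R) (s i) ≤ ∑ p, ζ i p * P.c p (it.x (s i)) ∧
      ‖∑ p, ζ i p • gradient (P.c p) (it.x (s i))‖ ≤
        √(2 * hi * it.gapBound P par (B * R) (s i)) + it.rhoPrev (s i) * B
          + it.gapBound P par (B * R) (s i) / r := by
    -- Index 0 is dropped: the eigenvalue bounds cover `[0, ρ_0]`, and the initial parameter may be
    -- larger.
    filter_upwards [eventually_ge_atTop 1] with i hi1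
    refine h.multiplier_estimate ha hr hball hR hhi (hj i) (fun t ht => ?_)
      (hB _ (hmem _).1).2.1 (hRed i)
    obtain ⟨q, hq⟩ : ∃ q, s i = q + 1 := ⟨s i - 1, by have := hs.id_le i; simp at this; lia⟩
    obtain ⟨q1, q2⟩ := h.rhoIn_mem (h.rhoPrev_pos (s i)) (j i) (hj i)
    refine (hspec (s i) _ ⟨q1.le, q2.trans ?_⟩ ht).2
    rw [hq]
    exact h.antitone_rho (Nat.zero_le q)
  have hrp : Tendsto it.rhoPrev atTop (𝓝 0) :=
    (tendsto_add_atTop_iff_nat 1).1 hrho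
  have hgap : Tendsto (fun i => it.gapBound P par (B * R) (s i)) atTop (𝓝 0) := by
    have hv := (P.continuous_v.tendsto z).comp hx
    rw [hM.1] at hv
    have hω := h.tendsto_omega.comp hs.tendsto_atTop
    have hρ := (hrp.comp hs.tendsto_atTop).mul_const (B * R)
    have := hv.add (((hv.add hω).add hρ).div_const par.betaPhi)
    simpa [gapBound] using this
  have hrs := hrp.comp hs.tendsto_atTop
  have hbound : Tendsto (fun i => √(2 * hi * it.gapBound P par (B * R) (s i))
      + it.rhoPrev (s i) * B + it.gapBound P par (B * R) (s i) / r) atTop (𝓝 0) := by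
    have h1 := (Real.continuous_sqrt.tendsto _).comp (hgap.const_mul (2 * hi))
    have := (h1.add (hrs.mul_const B)).add (hgap.div_const r)
    simpa using this
  have hone : ∀ i, ζ i ∈ Metric.closedBall (0 : Fin m → ℝ) 1 := fun i => by
    rw [mem_closedBall_zero_iff, pi_norm_le_iff_of_nonneg zero_le_one]
    exact fun p => QP.abs_zeta_le_one (Q := it.qp P X (s i)) (ha (s i))
      (h.u_feasible _ _ (hj i)) p
  obtain ⟨ζ', -, t, ht, hlim⟩ := (isCompact_closedBall (0 : Fin m → ℝ) 1).tendsto_subseq hone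
  have hlimp : ∀ p, Tendsto (fun i => ζ (t i) p) atTop (𝓝 (ζ' p)) := fun p =>
    (tendsto_pi_nhds.1 hlim) p
  have hxt := hx.comp ht.tendsto_atTop
  have hest' := ht.tendsto_atTop.eventually hest
  have hzero : ζ' = 0 := by
    refine hM.eq_zero (fun p hp => ?_) ?_ ?_
    · exact ge_of_tendsto (hlimp p) (hest'.mono fun i hi => hi.1 p hp)
    · have h1 : Tendsto (fun i => ∑ p, ζ (t i) p • gradient (P.c p) (it.x (s (t i)))) atTop
          (𝓝 (∑ p, ζ' p • gradient (P.c p) z)) :=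
        tendsto_finsetSum _ fun p _ => (hlimp p).smul
          (((continuous_gradient (P.c_smooth p)).tendsto z).comp hxt)
      have h2 : Tendsto (fun i => ∑ p, ζ (t i) p • gradient (P.c p) (it.x (s (t i)))) atTop
          (𝓝 0) :=
        squeeze_zero_norm' (hest'.mono fun i hi => hi.2.2) (hbound.comp ht.tendsto_atTop)
      exact tendsto_nhds_unique h1 h2
    · have h1 : Tendsto (fun i => ∑ p, ζ (t i) p * P.c p (it.x (s (t i)))) atTop
          (𝓝 (∑ p, ζ' p * P.c p z)) :=
        tendsto_finsetSum _ fun p _ => (hlimp p).mul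
          (((P.c_smooth p).continuous.tendsto z).comp hxt)
      have h2 := (hgap.comp ht.tendsto_atTop).neg
      rw [neg_zero] at h2
      exact le_of_tendsto_of_tendsto h2 h1 (hest'.mono fun i hi => hi.2.1)
  -- The index of the large multiplier may vary; the sup norm passes to the limit regardless.
  have hge : par.betaV ≤ ‖ζ'‖ := by
    refine ge_of_tendsto hlim.norm (Eventually.of_forall fun i => ?_)
    obtain ⟨p, hp⟩ := hζ (t i)
    exact hp.le.trans (norm_le_pi_norm (ζ (t i)) p)
  rw [hzero, norm_zero] at hge
  exact absurd par.betaV_mem.1 (not_lt.2 hge)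

/-! ### Convergence to stationary points of the infeasibility measure -/

lemma IsRun.dl_add_omega_pos (h : it.IsRun P X par)
    (ha : ∀ k i, 0 < ‖gradient (P.c i) (it.x k)‖) (h0 : (0 : Vec n) ∈ X) (k : ℕ) :
    0 < (it.qp P X k).dl (it.d k) 0 + it.omega k := by
  have h1 := (h.redV_iff ha h0 (le_refl (it.jEnd k))).1 (h.stopped k).2.2
  have h2 := h.max_D_w_lt ha h0 (le_refl (it.jEnd k))
  have h4 : (it.qp P X k).Jomega (it.omega k) = P.v (it.x k) + it.omega k := rfl
  rw [h4] at h2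
  have h3 := mul_pos par.betaV_mem.1 (sub_pos.2 h2)
  rw [dl_eq, zero_mul, zero_add]
  have h5 : it.d k = it.dIn k (it.jEnd k) := rfl
  rw [h5]
  linarith

/-- The properties of the final penalty parameter of an iteration. -/
lemma IsRun.dl_rho (h : it.IsRun P X par)
    (ha : ∀ k i, 0 < ‖gradient (P.c i) (it.x k)‖) (h0 : (0 : Vec n) ∈ X) (k : ℕ) :
    it.Posterior P X par k (it.rho k) ∧
    1 / 2 * quad ((it.qp P X k).H (it.rhoTilde k)) (it.d k) ≤
      (it.qp P X k).dl (it.d k) (it.rho k) := by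
  have hq := h.half_quad_le_dl h0 (le_refl (it.jEnd k))
  by_cases hP : it.Posterior P X par k (it.rhoTilde k)
  · rw [h.rho_keep k hP]
    exact ⟨hP, hq⟩
  · obtain ⟨h1, h2, h3⟩ := h.rho_reduce k hP
    have hpos := h.dl_add_omega_pos ha h0 k
    have hN : 0 < (1 - par.betaL) * ((it.qp P X k).dl (it.d k) 0 + it.omega k) := by
      have l2 := par.betaL_mem.2
      obtain ⟨b1, b2⟩ := par.betaV_mem
      obtain ⟨p1, p2⟩ := par.betaPhi_mem
      have : par.betaPhi * (1 - par.betaV) < 1 := by nlinarith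
      exact mul_pos (by linarith) hpos
    set q := inner ℝ (gradient P.f (it.x k)) (it.d k)
        + 1 / 2 * quad ((it.qp P X k).H (it.rho k)) (it.d k) with hqdef
    -- Division by zero would give `ρ_k = 0`.
    have hq0 : q ≠ 0 := by
      intro h0'
      rw [h0', div_zero] at h3
      exact h1.ne' h3
    rw [eq_div_iff hq0] at h3
    have hpd := h.H_posDef k (it.rho k) ⟨h1.le, h2.trans (h.rhoTilde_le k)⟩
    have hqn := mul_nonneg h1.le (quad_nonneg hpd (it.d k))
    rw [Posterior, not_le] at hP
    have hd0 := dl_eq (it := it) (P := P) (X := X) k (it.d k) 0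
    have hd1 := dl_eq (it := it) (P := P) (X := X) k (it.d k) (it.rho k)
    have hd2 := dl_eq (it := it) (P := P) (X := X) k (it.d k) (it.rhoTilde k)
    rw [zero_mul, zero_add] at hd0
    set g : ℝ := inner ℝ (gradient P.f (it.x k)) (it.d k)
    constructor
    · rw [Posterior]
      rw [hqdef] at h3
      linarith
    -- The test failed at `ρ̃_k`, so `ρ̃_k g` exceeds a positive number; lowering the parameter
    -- therefore increases the model reduction.
    · have hg : 0 < g := by
        have : 0 < it.rhoTilde k * g := by linarith
        exact pos_of_mul_pos_right this (h1.trans_le h2).le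
      have := mul_le_mul_of_nonneg_right h2 hg.le
      have hq' : 1 / 2 * quad ((it.qp P X k).H (it.rhoTilde k)) (it.d k) ≤
          (it.qp P X k).dl (it.d k) (it.rhoTilde k) := hq
      linarith

lemma IsRun.phi_succ_le (h : it.IsRun P X par) (k : ℕ) :
    P.phi (it.x (k + 1)) (it.rho k) - P.phi (it.x k) (it.rho k) ≤
      -par.thetaAlpha * it.alpha k * (it.qp P X k).dl (it.d k) (it.rho k) := by
  obtain ⟨i, hi, hls, -⟩ := h.alpha_eq k
  rw [h.x_succ k, hi]
  exact hls

/-- A lower bound for the stepsizes. -/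
lemma IsRun.le_alpha (h : it.IsRun P X par) {Ω : Set (Vec n)} (hΩo : IsOpen Ω)
    (hΩ : Convex ℝ Ω) {k : ℕ} (hx : it.x k ∈ Ω) (hxd : it.x k + it.d k ∈ Ω)
    (hf : DifferentiableOn ℝ P.f Ω ∧ DifferentiableOn ℝ (gradient P.f) Ω)
    (hc : ∀ i, DifferentiableOn ℝ (P.c i) Ω ∧ DifferentiableOn ℝ (gradient (P.c i)) Ω)
    {B lo M : ℝ} (hfB : ∀ x ∈ Ω, ‖fderiv ℝ (gradient P.f) x‖ ≤ B)
    (hcB : ∀ i, ∀ x ∈ Ω, ‖fderiv ℝ (gradient (P.c i)) x‖ ≤ B)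
    (hdl : lo / 2 * ‖it.d k‖ ^ 2 ≤ (it.qp P X k).dl (it.d k) (it.rho k))
    (hM : (it.rho k + m) * B ≤ M) (hM0 : 0 < M) :
    min 1 (par.gamma * ((1 - par.thetaAlpha) * lo / (2 * M))) ≤ it.alpha k := by
  obtain ⟨i, hi, -, hfail⟩ := h.alpha_eq k
  obtain ⟨g1, g2⟩ := par.gamma_mem
  obtain ⟨t1, t2⟩ := par.thetaAlpha_mem
  rcases i with _ | i
  · rw [hi, pow_zero]; exact min_le_left _ _
  refine (min_le_right _ _).trans ?_
  rw [hi, pow_succ']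
  refine mul_le_mul_of_nonneg_left ?_ g1.le
  have hs0 : 0 < par.gamma ^ i := by positivity
  have hs1 : par.gamma ^ i ≤ 1 := pow_le_one₀ g1.le g2.le
  -- The last rejected stepsize `s` violates the decrease condition; compared with `phi_step_le`,
  -- this bounds `s` from below.
  have hno := hfail i (Nat.lt_succ_self i)
  rw [LineSearch, not_le] at hno
  set s := par.gamma ^ i with hs
  have hy : it.x k + s • it.d k ∈ Ω := by
    have := hΩ.add_smul_sub_mem hx hxd ⟨hs0.le, hs1⟩
    rwa [add_sub_cancel_left] at this
  have hE : ∀ w : Vec n → ℝ, DifferentiableOn ℝ w Ω ∧ DifferentiableOn ℝ (gradient w) Ω →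
      (∀ x ∈ Ω, ‖fderiv ℝ (gradient w) x‖ ≤ B) →
      |w (it.x k + s • it.d k) - w (it.x k) - inner ℝ (gradient w (it.x k)) (s • it.d k)| ≤
        B * (s ^ 2 * ‖it.d k‖ ^ 2) := by
    intro w hw hwB
    have := abs_sub_sub_inner_gradient_le hΩo hΩ hw.1 hw.2 hwB hx hy
    rwa [add_sub_cancel_left, norm_smul, mul_pow, Real.norm_eq_abs, sq_abs] at this
  have hstep := P.phi_step_le ⟨hs0.le, hs1⟩ (h.rho_pos k).le (hE _ hf hfB)
    fun p => hE _ (hc p) (hcB p)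
  rw [← dl_eq (it := it) (P := P) (X := X)] at hstep
  set Δ := (it.qp P X k).dl (it.d k) (it.rho k)
  have h1 : (it.rho k + m) * (B * (s ^ 2 * ‖it.d k‖ ^ 2)) ≤ M * (s ^ 2 * ‖it.d k‖ ^ 2) := by
    rw [← mul_assoc]; gcongr
  have h2 : s * ((1 - par.thetaAlpha) * Δ) < s * (s * M * ‖it.d k‖ ^ 2) := by
    have e : M * (s ^ 2 * ‖it.d k‖ ^ 2) = s * (s * M * ‖it.d k‖ ^ 2) := by ring
    linarith
  have h3 := lt_of_mul_lt_mul_left h2 hs0.le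
  have h4 : (1 - par.thetaAlpha) * (lo / 2 * ‖it.d k‖ ^ 2) ≤ (1 - par.thetaAlpha) * Δ :=
    mul_le_mul_of_nonneg_left hdl (by linarith)
  have h5 : ((1 - par.thetaAlpha) * lo / 2) * ‖it.d k‖ ^ 2 < s * M * ‖it.d k‖ ^ 2 := by linarith
  have h6 := lt_of_mul_lt_mul_right h5 (by positivity)
  rw [div_le_iff₀ (by positivity)]
  linarith

/-- Adding the bound `Bf` to `f` makes the merit value `Φ` nonnegative and lets a smaller `ρ` only
decrease it. Hence `Φ` converges, and its decrements dominate a fixed multiple of `Δl`. -/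
lemma IsRun.tendsto_dl (h : it.IsRun P X par) (hG : GlobalAssumption P X it) :
    Tendsto (fun k => (it.qp P X k).dl (it.d k) (it.rho k)) atTop (𝓝 0) := by
  have ha := hG.gradient_pos
  have h0 : (0 : Vec n) ∈ X := interior_subset hG.zero_mem_interior
  obtain ⟨lo, hi, hlo, hlohi, hspec⟩ := hG.eigenvalues
  obtain ⟨Ω, hΩo, hΩ, hmem, ⟨hf1, hf2, Bf, hBf⟩, hc⟩ := hG.smooth
  choose hc1 hc2 Bc hBc using hc
  obtain ⟨t1, t2⟩ := par.thetaAlpha_mem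
  obtain ⟨g1, g2⟩ := par.gamma_mem
  set B := |Bf| + ∑ i, |Bc i| with hBdef
  have hB0 : 0 ≤ B := by positivity
  have hfB : ∀ x ∈ Ω, ‖fderiv ℝ (gradient P.f) x‖ ≤ B := fun x hx => by
    have := (hBf x hx).2.2
    have h2 := le_abs_self Bf
    have h3 : 0 ≤ ∑ i, |Bc i| := by positivity
    linarith
  have hcB : ∀ i, ∀ x ∈ Ω, ‖fderiv ℝ (gradient (P.c i)) x‖ ≤ B := fun i x hx => by
    have := (hBc i x hx).2.2
    have h2 := le_abs_self (Bc i)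
    have h3 := Finset.single_le_sum (f := fun i => |Bc i|) (fun i _ => abs_nonneg _)
      (Finset.mem_univ i)
    have h4 := abs_nonneg Bf
    linarith
  set M := (it.rho 0 + m) * B + 1 with hMdef
  have hρ0 := h.rho_pos 0
  have hM0 : 0 < M := by positivity
  set α := min 1 (par.gamma * ((1 - par.thetaAlpha) * lo / (2 * M))) with hα
  have hα0 : 0 < α := by
    have : 0 < 1 - par.thetaAlpha := by linarith
    exact lt_min one_pos (by positivity)
  set Δ : ℕ → ℝ := fun k => (it.qp P X k).dl (it.d k) (it.rho k) with hΔ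
  -- The shift is needed for the eigenvalue bound: `ρ̃_{k+1} ≤ ρ_0`, whereas `ρ̃_0` is only bounded
  -- by the initial parameter.
  have hlow : ∀ k, lo / 2 * ‖it.d (k + 1)‖ ^ 2 ≤ Δ (k + 1) := by
    intro k
    have h1 := (h.dl_rho ha h0 (k + 1)).2
    have hsym : ((it.qp P X (k + 1)).H (it.rhoTilde (k + 1))).IsSymm :=
      ((h.Hf_symm _).smul _).add (h.H0_symm _)
    have hmemρ : it.rhoTilde (k + 1) ∈ Set.Icc 0 (it.rho 0) :=
      ⟨(h.rho_pos (k + 1)).le.trans (h.rho_le_rhoTilde _),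
        (h.rhoTilde_le (k + 1)).trans (h.antitone_rho (Nat.zero_le k))⟩
    have h2 := le_quad_of_spectrum hsym (fun r hr => (hspec _ _ hmemρ hr).1) (it.d (k + 1))
    linarith
  have hΔ0 : ∀ k, 0 ≤ Δ (k + 1) := fun k => le_trans (by positivity) (hlow k)
  have hαk : ∀ k, α ≤ it.alpha (k + 1) := fun k => by
    refine h.le_alpha hΩo hΩ (hmem _).1 (hmem _).2 ⟨hf1, hf2⟩ (fun i => ⟨hc1 i, hc2 i⟩)
      hfB hcB (hlow k) ?_ hM0
    have := h.antitone_rho (Nat.zero_le (k + 1))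
    have : (it.rho (k + 1) + m) * B ≤ (it.rho 0 + m) * B := by gcongr
    linarith
  set Φ : ℕ → ℝ := fun k => it.rho k * (P.f (it.x k) + Bf) + P.v (it.x k) with hΦ
  have hfnn : ∀ k, 0 ≤ P.f (it.x k) + Bf := fun k => by
    have := (abs_le.1 (hBf _ (hmem k).1).1).1
    linarith
  have hΦ0 : ∀ k, 0 ≤ Φ k := fun k =>
    add_nonneg (mul_nonneg (h.rho_pos k).le (hfnn k)) (P.v_nonneg _)
  have hdec : ∀ k, par.thetaAlpha * α * Δ (k + 1) ≤ Φ (k + 1) - Φ (k + 1 + 1) := by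
    intro k
    have h1 := h.phi_succ_le (k + 1)
    have h2 : it.rho (k + 1 + 1) * (P.f (it.x (k + 1 + 1)) + Bf) ≤
        it.rho (k + 1) * (P.f (it.x (k + 1 + 1)) + Bf) :=
      mul_le_mul_of_nonneg_right (h.antitone_rho (Nat.le_succ _)) (hfnn _)
    have h3 : par.thetaAlpha * α * Δ (k + 1) ≤ par.thetaAlpha * it.alpha (k + 1) * Δ (k + 1) :=
      mul_le_mul_of_nonneg_right (mul_le_mul_of_nonneg_left (hαk k) t1.le) (hΔ0 k)
    simp only [hΦ, NLP.phi, hΔ] at *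
    linarith
  have hanti : Antitone fun k => Φ (k + 1) := antitone_nat_of_succ_le fun k => by
    have := mul_nonneg (mul_pos t1 hα0).le (hΔ0 k)
    linarith [hdec k]
  have hlim := tendsto_atTop_ciInf hanti ⟨0, by rintro _ ⟨k, rfl⟩; exact hΦ0 _⟩
  have hdiff := hlim.sub (hlim.comp (tendsto_add_atTop_nat 1))
  rw [sub_self] at hdiff
  have hprod : Tendsto (fun k => par.thetaAlpha * α * Δ (k + 1)) atTop (𝓝 0) :=
    squeeze_zero (fun k => mul_nonneg (mul_pos t1 hα0).le (hΔ0 k)) hdec hdiff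
  have := hprod.const_mul (par.thetaAlpha * α)⁻¹
  rw [mul_zero] at this
  refine (tendsto_add_atTop_iff_nat 1).1 (this.congr fun k => ?_)
  rw [inv_mul_cancel_left₀ (mul_pos t1 hα0).ne']

/-- Every limit point of the iterates is stationary for the infeasibility measure. -/
lemma IsRun.stationaryForViolation (h : it.IsRun P X par) (hG : GlobalAssumption P X it)
    {z : Vec n} {s : ℕ → ℕ} (hs : StrictMono s)
    (hx : Tendsto (fun i => it.x (s i)) atTop (𝓝 z)) : P.StationaryForViolation z := by
  have ha := hG.gradient_pos
  have h0 : (0 : Vec n) ∈ X := interior_subset hG.zero_mem_interior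
  obtain ⟨lo, hi, hlo, hlohi, hspec⟩ := hG.eigenvalues
  have l1 := par.betaL_mem.1
  have b1 := par.betaV_mem.1
  refine P.stationaryForViolation_of_le hG.zero_mem_interior (K := 1 / 2 * hi) fun d hd => ?_
  set e : ℕ → ℝ := fun k =>
    ((it.qp P X k).dl (it.d k) (it.rho k) + it.omega k) / par.betaL / par.betaV with he
  have hek : Tendsto e atTop (𝓝 0) := by
    simpa using (((h.tendsto_dl hG).add h.tendsto_omega).div_const par.betaL).div_const par.betaV
  -- The posterior test costs the factor `1 / β_l` and (Rv) the factor `1 / β_v`. Weak duality for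
  -- `w` then replaces the dual value by the model at an arbitrary `d ∈ X`.
  have hle : ∀ k, P.v (it.x k) - e k ≤ P.vModel (it.x k) d + 1 / 2 * hi * ‖d‖ ^ 2 := by
    intro k
    have h1 := (h.dl_rho ha h0 k).1
    rw [Posterior, ← le_div_iff₀' l1, dl_eq, zero_mul, zero_add] at h1
    have h2 := (h.redV_iff ha h0 (le_refl (it.jEnd k))).1 (h.stopped k).2.2
    have h3 : it.d k = it.dIn k (it.jEnd k) := rfl
    have h4 : P.v (it.x k) + it.omega k
        - max ((it.qp P X k).D (it.wIn k (it.jEnd k)) 0).toReal 0 ≤ e k := by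
      rw [he, le_div_iff₀' b1]
      refine h2.trans (le_trans (le_of_eq ?_) h1)
      rw [h3]; ring
    have h5 := h.D_w_le ha h0 (le_refl (it.jEnd k)) hd
    have hsym : ((it.qp P X k).H 0).IsSymm := ((h.Hf_symm _).smul _).add (h.H0_symm _)
    have h6 := quad_le_of_spectrum hsym
      (fun r hr => (hspec k 0 ⟨le_rfl, (h.rho_pos 0).le⟩ hr).2) d
    have h7 : 0 ≤ P.vModel (it.x k) d := Finset.sum_nonneg fun _ _ => viol_nonneg _
    have h8 : 0 ≤ hi * ‖d‖ ^ 2 := mul_nonneg (hlo.le.trans hlohi) (sq_nonneg _)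
    have h9 : max ((it.qp P X k).D (it.wIn k (it.jEnd k)) 0).toReal 0 ≤
        P.vModel (it.x k) d + 1 / 2 * hi * ‖d‖ ^ 2 := max_le (by linarith) (by linarith)
    linarith [h.omega_pos k]
  have hlim1 : Tendsto (fun i => P.v (it.x (s i)) - e (s i)) atTop (𝓝 (P.v z)) := by
    simpa using ((P.continuous_v.tendsto z).comp hx).sub (hek.comp hs.tendsto_atTop)
  have hlim2 : Tendsto (fun i => P.vModel (it.x (s i)) d + 1 / 2 * hi * ‖d‖ ^ 2) atTop
      (𝓝 (P.vModel z d + 1 / 2 * hi * ‖d‖ ^ 2)) :=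
    (((P.continuous_vModel d).tendsto z).comp hx).add_const _
  exact le_of_tendsto_of_tendsto' hlim1 hlim2 fun i => hle (s i)

end Iterates

end PenaltySQP

theorem mainTheorem3 {n m : ℕ} (P : PenaltySQP.NLP n m) (X : Set (PenaltySQP.Vec n))
    (par : PenaltySQP.Params) (it : PenaltySQP.Iterates n m)
    (hrun : it.IsRun P X par) (hglobal : PenaltySQP.GlobalAssumption P X it)
    (hrho : Tendsto it.rho atTop (𝓝 0)) :
    ∀ z : PenaltySQP.Vec n,
      PenaltySQP.IsLimitPointAlong it.x (it.setD P X par ∪ it.setT) z →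
        P.InfeasibleStationary z ∨ (P.Feasible z ∧ ¬ P.MFCQ z) := by
  rintro z ⟨s, hs, hmem, hx⟩
  by_cases hfeas : P.Feasible z
  · have h0 : (0 : PenaltySQP.Vec n) ∈ X := interior_subset hglobal.zero_mem_interior
    choose j hj hRed hζ using fun i => hrun.exists_zeta_gt hglobal.gradient_pos h0 (hmem i)
    exact Or.inr ⟨hfeas, hrun.not_MFCQ hglobal hrho hs hx hj hRed hζ⟩
  · exact Or.inl ⟨hfeas, hrun.stationaryForViolation hglobal hs hx⟩
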